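/- Let $m\ge 1$ and let $(\overline M^{2m+1},\varphi,\xi,\eta,\overline g)$ be a Sasakian space form of constant $\varphi$-sectional curvature $c$, i.e. a Sasakian manifold ($d\eta(X,Y)=\overline g(X,\varphi Y)$, $(\overline\nabla_X\varphi)Y=\overline g(X,Y)\xi-\overline g(Y,\xi)X$) with curvature tensor $\overline R(X,Y)Z=\frac{c+3}{4}\{\overline g(Y,Z)X-\overline g(X,Z)Y\}-\frac{c-1}{4}\{\eta(Z)[\eta(Y)X-\eta(X)Y]+[\overline g(Y,Z)\eta(X)-\overline g(X,Z)\eta(Y)]\xi+\overline g(\varphi X,Z)\varphi Y+2\overline g(\varphi X,Y)\varphi Z-\overline g(\varphi Y,Z)\varphi X\}$. Assume that its Ricci tensor is nondegenerate (equivalently $(m+1)c+3m-1\neq0$), and let $\nabla^\star$, $R^\star$ be the Levi-Civita connection and the curvature tensor of the (possibly indefinite) metric $\mathrm{Ric}$. Let $\psi:M^{2m}\to\overline M^{2m+1}$ be an immersed hypersurface with the metric $g=\psi^*\overline g$, let $N$ be a unit normal, $A$ the Weingarten operator with respect to $N$, $V=-\varphi N$, and let $H=\frac1{2m}(\operatorname{trace}A)\,N$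 be the mean curvature vector field with respect to $\overline g$. Assume that * $M$ is a pseudo-Hopf hypersurface: $\xi$ is tangent to $M$ and $A$ maps $\operatorname{Span}\{\xi,V\}$ into itself; * $M$ is Ricci-biharmonic: $\tau_2^\star(\psi)=-\Delta^\star H-\operatorname{trace}R^\star(d\psi(\cdot),H)d\psi(\cdot)=0$, where $\Delta^\star=-\operatorname{trace}_g(\nabla^\star)^2$ is the rough Laplacian on sections of $\psi^{-1}T\overline M$ (the second covariant derivative being formed with the Levi-Civita connection of $g$ on $M$), and the trace in the curvature term is taken either with respect to $g$ or with respect to $\psi^*\mathrm{Ric}$ (the statement holds for both conventions); * $|H|$ is differentiable and $\operatorname{grad}|H|=\alpha\xi+\beta V$ for functions $\alpha,\beta$ on $M$. Then: 1. If $\alpha=0$ on $M$ and $M$ is connected, then $|H|$ is constant. 2. There is an absolute constant $m_0$ such that, if $m\ge m_0$ and $c>1$, then there is no point of $M$ at which $\alpha\ne0$; that is, no such hypersurface with $\alpha\neq0$ exists. 3. Let $p\in M$ be a point with $\alpha(p)\neq0$ and $H(p)=|H|(p)N(p)$, and let $\gamma_1,\gamma_2$ be the eigenvalues of $A$ at $p$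 on $\operatorname{Span}\{\xi,V\}$: $AW_1=\gamma_1W_1$, $AW_2=\gamma_2W_2$ with $W_1=\cos\theta\,\xi+\sin\theta\,V$, $W_2=-\sin\theta\,\xi+\cos\theta\,V$, $0<\theta<\frac\pi2$. If $\gamma_1+\gamma_2\neq0$, then $c<\frac{1-3m}{1+m}$ or $c>1$, and at $p$, for one of the two signs, $$|H|=\frac12\left(-\frac{-1+m(\gamma_1+\gamma_2)}{m^2}\pm\sqrt{\frac{-\frac{4(-1+c)m^2(1+m)}{-1+c+3m+cm}+\bigl(-1+m(\gamma_1+\gamma_2)\bigr)^2}{m^4}}\right),$$ where the number under the square root is nonnegative. -/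

import Mathlib

open scoped Manifold ContDiff Bundle

noncomputable section

/-- The coordinate space `ℝⁿ`. -/
abbrev Eu (n : ℕ) : Type := EuclideanSpace ℝ (Fin n)

/-! ### Riemannian geometry in coordinates

A field of bilinear forms on (an open subset of) `ℝⁿ` is written `G : Eu n → Eu n → Eu n → Eu n → ℝ`;
`G y v w` is its value at the point `y` on the vectors `v` and `w`. -/

namespace Coord

/-- The `i`-th coordinate vector field `∂ᵢ`. -/
def e {n : ℕ} (i : Fin n) : Eu n := EuclideanSpace.single i 1

/-- The matrix `(b(∂ᵢ, ∂ⱼ))` of a bilinear form. -/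
def gram {n : ℕ} (b : Eu n → Eu n → ℝ) : Matrix (Fin n) (Fin n) ℝ :=
  Matrix.of fun i j => b (e i) (e j)

/-- The trace `∑ bⁱʲ T(∂ᵢ, ∂ⱼ)` of a vector valued bilinear map `T` with respect to the
nondegenerate symmetric bilinear form `b`. -/
def traceWrt {n k : ℕ} (b : Eu n → Eu n → ℝ) (T : Eu n → Eu n → Eu k) : Eu k :=
  ∑ i, ∑ j, (gram b)⁻¹ i j • T (e i) (e j)

/-- Christoffel symbols of the (possibly indefinite) metric `G`: the vector with components
`Γᵏ(v, w) = ∑ₗ gᵏˡ · ½ (∂ᵥ G(w, ∂ₗ) + ∂_w G(v, ∂ₗ) - ∂ₗ G(v, w))`. -/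
def christoffel {n : ℕ} (G : Eu n → Eu n → Eu n → ℝ) (y v w : Eu n) : Eu n :=
  WithLp.toLp 2 fun k => ∑ l, (gram (G y))⁻¹ k l *
    ((1 / 2 : ℝ) * (fderiv ℝ (fun z => G z w (e l)) y v + fderiv ℝ (fun z => G z v (e l)) y w
      - fderiv ℝ (fun z => G z v w) y (e l)))

/-- The covariant derivative `∇_v Y` at `y` of the vector field `Y`, for the Levi-Civita
connection of `G`. -/
def cov {n : ℕ} (G : Eu n → Eu n → Eu n → ℝ) (Y : Eu n → Eu n) (y v : Eu n) : Eu n :=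
  fderiv ℝ Y y v + christoffel G y v (Y y)

/-- The curvature `R(u, v) w = ∇_u ∇_v w - ∇_v ∇_u w` of the Levi-Civita connection of `G`, where
`u`, `v`, `w` are extended as constant (hence commuting) coordinate fields, so that the field
`∇_v w` is `z ↦ Γ_z(v, w)`. -/
def riemann {n : ℕ} (G : Eu n → Eu n → Eu n → ℝ) (y u v w : Eu n) : Eu n :=
  cov G (fun z => christoffel G z v w) y u - cov G (fun z => christoffel G z u w) y v

/-- The Ricci tensor `Ric(v, w) = trace (u ↦ R(u, v) w)`. -/
def ricci {n : ℕ} (G : Eu n → Eu n → Eu n → ℝ) (y v w : Eu n) : ℝ :=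
  ∑ i, riemann G y (e i) v w i

/-- The pull-back `f^* G`. -/
def induced {k n : ℕ} (G : Eu n → Eu n → Eu n → ℝ) (f : Eu k → Eu n) (u v w : Eu k) : ℝ :=
  G (f u) (fderiv ℝ f u v) (fderiv ℝ f u w)

/-- The covariant derivative `∇_v Z` at `u` of a vector field `Z` along the map `f`, for the
pull-back by `f` of the Levi-Civita connection of `G`. -/
def covAlong {k n : ℕ} (G : Eu n → Eu n → Eu n → ℝ) (f : Eu k → Eu n) (Z : Eu k → Eu n)
    (u v : Eu k) : Eu n :=
  fderiv ℝ Z u v + christoffel G (f u) (fderiv ℝ f u v) (Z u)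

/-- The second covariant derivative `∇²_{v, w} Z = ∇_v (∇_w Z) - ∇_{D_v w} Z` of a vector field
along `f`; `∇` is the pull-back of the Levi-Civita connection of `G` and `D` is the Levi-Civita
connection of the metric `h` on the source. -/
def secondCov {k n : ℕ} (h : Eu k → Eu k → Eu k → ℝ) (G : Eu n → Eu n → Eu n → ℝ)
    (f : Eu k → Eu n) (Z : Eu k → Eu n) (u v w : Eu k) : Eu n :=
  covAlong G f (fun t => covAlong G f Z t w) u v - covAlong G f Z u (christoffel h u v w)

/-- The bitension field `τ₂* = -Δ* H - trace R*(df ·, H) df ·` of the immersion `f` into a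
space with metric `G`. Here `∇*` and `R*` are the Levi-Civita connection and the curvature of the
Ricci tensor of `G`, `Δ* = - trace (∇*)²` is the rough Laplacian on fields along `f` for
the induced metric `f^* G`, and `b` is the metric used to contract the curvature term. -/
def bitension {k n : ℕ} (G : Eu n → Eu n → Eu n → ℝ) (f : Eu k → Eu n) (H : Eu k → Eu n)
    (b : Eu k → Eu k → Eu k → ℝ) (u : Eu k) : Eu n :=
  traceWrt (induced G f u) (secondCov (induced G f) (ricci G) f H u)
    - traceWrt (b u) fun v w =>
        riemann (ricci G) (f u) (fderiv ℝ f u v) (H u) (fderiv ℝ f u w)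

end Coord

/-! ### Coordinate expressions on a manifold -/

section Charts

variable {n k : ℕ} {P : Type*} [TopologicalSpace P] [ChartedSpace (Eu n) P]
  {M : Type*} [TopologicalSpace M] [ChartedSpace (Eu k) M]

/-- The components in the chart `c` of a tangent vector at `x`. -/
def toCoord (c : OpenPartialHomeomorph P (Eu n)) (x : P) (v : TangentSpace (𝓡 n) x) : Eu n :=
  mfderiv (𝓡 n) (𝓡 n) c x v

/-- The tangent vector at `c.symm y` with components `v` in the chart `c`. -/
def ofCoord (c : OpenPartialHomeomorph P (Eu n)) (y v : Eu n) : TangentSpace (𝓡 n) (c.symm y) :=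
  mfderiv (𝓡 n) (𝓡 n) c.symm y v

/-- Coordinate expression of a map in the charts `c` and `d`. -/
def mapIn (c : OpenPartialHomeomorph M (Eu k)) (d : OpenPartialHomeomorph P (Eu n))
    (ψ : M → P) (u : Eu k) : Eu n :=
  d (ψ (c.symm u))

/-- The open set on which the coordinate expression of `ψ` in the charts `c`, `d` lives. -/
def domIn (c : OpenPartialHomeomorph M (Eu k)) (d : OpenPartialHomeomorph P (Eu n))
    (ψ : M → P) : Set (Eu k) :=
  {u | u ∈ c.target ∧ ψ (c.symm u) ∈ d.source}

/-- Coordinate expression of a vector field along `ψ`. -/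
def alongIn (c : OpenPartialHomeomorph M (Eu k)) (d : OpenPartialHomeomorph P (Eu n))
    (ψ : M → P) (Z : ∀ p : M, TangentSpace (𝓡 n) (ψ p)) (u : Eu k) : Eu n :=
  toCoord d (ψ (c.symm u)) (Z (c.symm u))

/-- Coordinate expression of a field of endomorphisms. -/
def endoIn (c : OpenPartialHomeomorph P (Eu n))
    (F : ∀ x : P, TangentSpace (𝓡 n) x →L[ℝ] TangentSpace (𝓡 n) x) (y v : Eu n) : Eu n :=
  toCoord c (c.symm y) (F (c.symm y) (ofCoord c y v))

end Charts

/-! ### Sasakian space forms -/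

/-- A Riemannian metric `g`, a `(1,1)`-tensor field `φ`, a vector field `ξ` and a one-form `η` on an
`n`-dimensional manifold, all smooth (for `η`, smoothness follows from `η = g(ξ, ·)` below). -/
structure ContactData (n : ℕ) (P : Type*) [TopologicalSpace P] [ChartedSpace (Eu n) P]
    [IsManifold (𝓡 n) ∞ P] where
  g : Bundle.ContMDiffRiemannianMetric (𝓡 n) ∞ (Eu n) (fun x : P => TangentSpace (𝓡 n) x)
  φ : ∀ x : P, TangentSpace (𝓡 n) x →L[ℝ] TangentSpace (𝓡 n) x
  ξ : ∀ x : P, TangentSpace (𝓡 n) x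
  η : ∀ x : P, TangentSpace (𝓡 n) x →L[ℝ] ℝ
  smooth_φ : ContMDiff (𝓡 n) ((𝓡 n).prod 𝓘(ℝ, Eu n →L[ℝ] Eu n)) ∞
    (fun x => Bundle.TotalSpace.mk' (Eu n →L[ℝ] Eu n)
      (E := fun x : P => TangentSpace (𝓡 n) x →L[ℝ] TangentSpace (𝓡 n) x) x (φ x))
  smooth_ξ : ContMDiff (𝓡 n) ((𝓡 n).prod 𝓘(ℝ, Eu n)) ∞
    (fun x => Bundle.TotalSpace.mk' (Eu n) (E := fun x : P => TangentSpace (𝓡 n) x) x (ξ x))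

namespace ContactData

variable {n : ℕ} {P : Type*} [TopologicalSpace P] [ChartedSpace (Eu n) P]
  [IsManifold (𝓡 n) ∞ P] (S : ContactData n P)

/-- Coordinate expression of the metric. -/
def gIn (c : OpenPartialHomeomorph P (Eu n)) (y v w : Eu n) : ℝ :=
  S.g.inner (c.symm y) (ofCoord c y v) (ofCoord c y w)

/-- Coordinate expression of the one-form `η`. -/
def ηIn (c : OpenPartialHomeomorph P (Eu n)) (y v : Eu n) : ℝ :=
  S.η (c.symm y) (ofCoord c y v)

/-- Coordinate expression of the vector field `ξ`. -/
def ξIn (c : OpenPartialHomeomorph P (Eu n)) (y : Eu n) : Eu n :=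
  toCoord c (c.symm y) (S.ξ (c.symm y))

/-- `(φ, ξ, η, g)` is an almost contact metric structure. -/
structure IsAlmostContactMetric : Prop where
  φ_sq : ∀ x v, S.φ x (S.φ x v) = -v + S.η x v • S.ξ x
  η_ξ : ∀ x, S.η x (S.ξ x) = 1
  φ_ξ : ∀ x, S.φ x (S.ξ x) = 0
  η_eq : ∀ x v, S.η x v = S.g.inner x (S.ξ x) v
  g_φ : ∀ x v w, S.g.inner x (S.φ x v) (S.φ x w) = S.g.inner x v w - S.η x v * S.η x w

/-- `(φ, ξ, η, g)` is a Sasakian structure: an almost contact metric structure with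
`dη(X, Y) = g(X, φ Y)`, where `2 dη(X, Y) = X η(Y) - Y η(X) - η([X, Y])`, and
`(∇_X φ) Y = g(X, Y) ξ - g(Y, ξ) X`. The last two identities are written in the charts of
the atlas, with `X = v` and `Y = w` coordinate fields. -/
structure IsSasakian : Prop extends S.IsAlmostContactMetric where
  contact : ∀ c ∈ atlas (Eu n) P, ∀ y ∈ c.target, ∀ v w : Eu n,
    (1 / 2 : ℝ) * (fderiv ℝ (fun z => S.ηIn c z w) y v - fderiv ℝ (fun z => S.ηIn c z v) y w)
      = S.gIn c y v (endoIn c S.φ y w)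
  cov_φ : ∀ c ∈ atlas (Eu n) P, ∀ y ∈ c.target, ∀ v w : Eu n,
    Coord.cov (S.gIn c) (fun z => endoIn c S.φ z w) y v
        - endoIn c S.φ y (Coord.christoffel (S.gIn c) y v w)
      = S.gIn c y v w • S.ξIn c y - S.gIn c y w (S.ξIn c y) • v

/-- A Sasakian space form: a Sasakian manifold of constant `φ`-sectional curvature `c`, i.e. with
the curvature tensor
`R(X,Y)Z = -(c-1)/4 {η(Z)[η(Y)X - η(X)Y] + [g(Y,Z)η(X) - g(X,Z)η(Y)]ξ
  + g(φX,Z)φY + 2g(φX,Y)φZ - g(φY,Z)φX} + (c+3)/4 {g(Y,Z)X - g(X,Z)Y}`. -/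
structure IsSasakianSpaceForm (c : ℝ) : Prop extends S.IsSasakian where
  curvature : ∀ d ∈ atlas (Eu n) P, ∀ y ∈ d.target, ∀ X Y Z : Eu n,
    Coord.riemann (S.gIn d) y X Y Z =
      (-((c - 1) / 4)) •
        (S.ηIn d y Z • (S.ηIn d y Y • X - S.ηIn d y X • Y)
          + (S.gIn d y Y Z * S.ηIn d y X - S.gIn d y X Z * S.ηIn d y Y) • S.ξIn d y
          + S.gIn d y (endoIn d S.φ y X) Z • endoIn d S.φ y Y
          + (2 * S.gIn d y (endoIn d S.φ y X) Y) • endoIn d S.φ y Z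
          - S.gIn d y (endoIn d S.φ y Y) Z • endoIn d S.φ y X)
      + ((c + 3) / 4) • (S.gIn d y Y Z • X - S.gIn d y X Z • Y)

/-- The Ricci tensor is nondegenerate at every point, so that it is a (possibly indefinite)
metric with a Levi-Civita connection. -/
def RicciNondegenerate : Prop :=
  ∀ c ∈ atlas (Eu n) P, ∀ y ∈ c.target, ∀ v : Eu n, v ≠ 0 →
    ∃ w : Eu n, Coord.ricci (S.gIn c) y v w ≠ 0

end ContactData

/-! ### Hypersurfaces -/

section Hypersurface

variable {k n : ℕ} {P : Type*} [TopologicalSpace P] [ChartedSpace (Eu n) P]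
  [IsManifold (𝓡 n) ∞ P] (S : ContactData n P)
  {M : Type*} [TopologicalSpace M] [ChartedSpace (Eu k) M]

/-- A smooth immersion. -/
def IsSmoothImmersion (ψ : M → P) : Prop :=
  ContMDiff (𝓡 k) (𝓡 n) ∞ ψ ∧ ∀ p, Function.Injective (mfderiv (𝓡 k) (𝓡 n) ψ p)

variable (ψ : M → P)

/-- `N` is a unit vector normal to the hypersurface at each point. No continuity in the point is
required: locally `N` is, up to a sign at each point, a smooth unit normal field. -/
def IsUnitNormal (N : ∀ p : M, TangentSpace (𝓡 n) (ψ p)) : Prop :=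
  ∀ p, S.g.inner (ψ p) (N p) (N p) = 1 ∧
    ∀ v, S.g.inner (ψ p) (N p) (mfderiv (𝓡 k) (𝓡 n) ψ p v) = 0

/-- `A` is the Weingarten (shape) operator of the hypersurface for the unit normal `N`:
`g(A X, Y) = g(B(X, Y), N) = g(∇_X Y, N)` for `X`, `Y` tangent to `M`, where `g` on `M` is the
induced metric and `∇` the Levi-Civita connection of the ambient manifold. (`X = v` and `Y = w`
are taken to be coordinate fields of charts of `M`.) -/
def IsShapeOperator (N : ∀ p : M, TangentSpace (𝓡 n) (ψ p))
    (A : ∀ p : M, TangentSpace (𝓡 k) p →L[ℝ] TangentSpace (𝓡 k) p) : Prop :=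
  ∀ c ∈ atlas (Eu k) M, ∀ d ∈ atlas (Eu n) P, ∀ u ∈ domIn c d ψ, ∀ v w : Eu k,
    Coord.induced (S.gIn d) (mapIn c d ψ) u (endoIn c A u v) w
      = S.gIn d (mapIn c d ψ u)
          (Coord.covAlong (S.gIn d) (mapIn c d ψ) (fun t => fderiv ℝ (mapIn c d ψ) t w) u v)
          (alongIn c d ψ N u)

/-- The vector field `V = -φ N` along the hypersurface. -/
def structV (N : ∀ p : M, TangentSpace (𝓡 n) (ψ p)) (p : M) : TangentSpace (𝓡 n) (ψ p) :=
  -S.φ (ψ p) (N p)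

/-- Pseudo-Hopf hypersurface: `ξ` is tangent to `M` and the shape operator maps
`D^⊥ = Span{ξ, V}` into itself. -/
def IsPseudoHopf (N : ∀ p : M, TangentSpace (𝓡 n) (ψ p))
    (A : ∀ p : M, TangentSpace (𝓡 k) p →L[ℝ] TangentSpace (𝓡 k) p) : Prop :=
  (∀ p : M, ∃ v : TangentSpace (𝓡 k) p, mfderiv (𝓡 k) (𝓡 n) ψ p v = S.ξ (ψ p)) ∧
  ∀ (p : M) (X : TangentSpace (𝓡 k) p),
    mfderiv (𝓡 k) (𝓡 n) ψ p X ∈ Submodule.span ℝ {S.ξ (ψ p), structV S ψ N p} →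
    mfderiv (𝓡 k) (𝓡 n) ψ p (A p X) ∈ Submodule.span ℝ {S.ξ (ψ p), structV S ψ N p}

/-- The mean curvature vector field `H = (1 / k) trace B = (1 / k) (trace A) N`, `k = dim M`. -/
def meanCurv (N : ∀ p : M, TangentSpace (𝓡 n) (ψ p))
    (A : ∀ p : M, TangentSpace (𝓡 k) p →L[ℝ] TangentSpace (𝓡 k) p) (p : M) :
    TangentSpace (𝓡 n) (ψ p) :=
  ((1 / (k : ℝ)) * LinearMap.trace ℝ (TangentSpace (𝓡 k) p) (A p).toLinearMap) • N p

/-- The mean curvature `|H| = √ g(H, H)`. -/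
def normH (N : ∀ p : M, TangentSpace (𝓡 n) (ψ p))
    (A : ∀ p : M, TangentSpace (𝓡 k) p →L[ℝ] TangentSpace (𝓡 k) p) (p : M) : ℝ :=
  √(S.g.inner (ψ p) (meanCurv ψ N A p) (meanCurv ψ N A p))

/-- `|H|` is differentiable on `M` and `grad |H| = Z`, for a field `Z` of vectors tangent
to `M` (seen as vectors of the ambient manifold): `d|H|(X) = g(Z, X)`. -/
def IsGradNormH (N : ∀ p : M, TangentSpace (𝓡 n) (ψ p))
    (A : ∀ p : M, TangentSpace (𝓡 k) p →L[ℝ] TangentSpace (𝓡 k) p)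
    (Z : ∀ p : M, TangentSpace (𝓡 n) (ψ p)) : Prop :=
  ∀ p, MDifferentiableAt (𝓡 k) 𝓘(ℝ, ℝ) (normH S ψ N A) p ∧
    ∀ v : TangentSpace (𝓡 k) p, mfderiv (𝓡 k) 𝓘(ℝ, ℝ) (normH S ψ N A) p v
      = S.g.inner (ψ p) (Z p) (mfderiv (𝓡 k) (𝓡 n) ψ p v)

/-- Ricci-biharmonic hypersurface: the bitension field `τ₂*` of the connection of the
metric `Ric` vanishes. The curvature term may be contracted with the induced metric `ψ^* g`
(first case) or with the pull-back `ψ^* Ric` (second case); both conventions are covered. -/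
def IsRicciBiharmonic (N : ∀ p : M, TangentSpace (𝓡 n) (ψ p))
    (A : ∀ p : M, TangentSpace (𝓡 k) p →L[ℝ] TangentSpace (𝓡 k) p) : Prop :=
  (∀ c ∈ atlas (Eu k) M, ∀ d ∈ atlas (Eu n) P, ∀ u ∈ domIn c d ψ,
    Coord.bitension (S.gIn d) (mapIn c d ψ) (alongIn c d ψ (meanCurv ψ N A))
      (Coord.induced (S.gIn d) (mapIn c d ψ)) u = 0) ∨
  (∀ c ∈ atlas (Eu k) M, ∀ d ∈ atlas (Eu n) P, ∀ u ∈ domIn c d ψ,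
    Coord.bitension (S.gIn d) (mapIn c d ψ) (alongIn c d ψ (meanCurv ψ N A))
      (Coord.induced (Coord.ricci (S.gIn d)) (mapIn c d ψ)) u = 0)

end Hypersurface

end

/-!
On a Sasakian space form `Ric = a g + b η ⊗ η` with constant `a`, `b`, and nondegeneracy forces
`a ≠ 0`. Hence the Levi-Civita connection of `Ric` is `∇* = ∇ - (b / a) (η ⊗ φ + φ ⊗ η)`. It
satisfies `η(∇*_X Z) = X η(Z) + g(Z, φ X)`, just as `∇` does, because `η ∘ φ = 0`.

Let `H = h N` locally. The curvature term of `τ₂*` has no `ξ`-component. In the `ξ`-component of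
`trace (∇*)² H` the terms in which `h` is not differentiated add up to the trace of a commutator
of the Weingarten operator `A` with the tangential part of `φ`, and what remains is `2 dh(V)`.
So biharmonicity gives `dh(V) = 0`. Moreover `ξ` is a tangent Killing field, so its flow preserves
the first and second fundamental forms; thus `[L_ξ, A] = 0` and `dh(ξ) = 0`.

Since `grad |H|` lies in `Span{ξ, V}`, it vanishes: `|H|` is locally constant and `α = β = 0`,
which settles all three parts, the last two because no point has `α ≠ 0`.
-/

noncomputable section

set_option maxSynthPendingDepth 3

/-! ### Nondegenerate bilinear forms and Levi-Civita connections -/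

namespace Coord

section Bilinear

variable {E : Type*} [NormedAddCommGroup E] [NormedSpace ℝ E] {b : E →L[ℝ] E →L[ℝ] ℝ}

lemma isInvertible_of_nondegenerate [FiniteDimensional ℝ E] (hb : ∀ v, v ≠ 0 → ∃ w, b v w ≠ 0) :
    b.IsInvertible := by
  have hinj : Function.Injective b := by
    refine (injective_iff_map_eq_zero b).2 fun v hv => ?_
    by_contra hv0
    obtain ⟨w, hw⟩ := hb v hv0
    exact hw (by rw [hv, _root_.zero_apply])
  have hdim : Module.finrank ℝ E = Module.finrank ℝ (E →L[ℝ] ℝ) := by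
    rw [← (LinearMap.toContinuousLinearMap (𝕜 := ℝ) (E := E) (F' := ℝ)).finrank_eq]
    exact (Subspace.dual_finrank_eq (K := ℝ) (V := E)).symm
  exact ⟨(LinearEquiv.ofInjectiveOfFinrankEq b.toLinearMap hinj hdim).toContinuousLinearEquiv,
    ContinuousLinearMap.ext fun v => rfl⟩

lemma isInvertible_of_pos [FiniteDimensional ℝ E] (hb : ∀ v, v ≠ 0 → 0 < b v v) :
    b.IsInvertible :=
  isInvertible_of_nondegenerate fun v hv => ⟨v, (hb v hv).ne'⟩

lemma eq_of_forall_apply_eq (hb : b.IsInvertible) {v w : E} (h : ∀ x, b v x = b w x) : v = w :=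
  hb.injective (ContinuousLinearMap.ext h)

lemma trace_eq_zero_of_skew [FiniteDimensional ℝ E] (hb : b.IsInvertible) {L : E →L[ℝ] E}
    (hL : ∀ v w, b (L v) w = -b v (L w)) : LinearMap.trace ℝ E L = 0 := by
  obtain ⟨B, rfl⟩ := hb
  let B' : E ≃ₗ[ℝ] Module.Dual ℝ E := B.toLinearEquiv.trans LinearMap.toContinuousLinearMap.symm
  have hconj : Module.Dual.transpose (R := ℝ) (L : E →ₗ[ℝ] E) = B'.conj (-L : E →ₗ[ℝ] E) := by
    refine LinearMap.ext fun K => LinearMap.ext fun w => ?_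
    have hK : ∀ x, B (B'.symm K) x = K x := LinearMap.congr_fun (B'.apply_symm_apply K)
    calc K (L w) = -B (L (B'.symm K)) w := by rw [← hK]; exact (neg_eq_iff_eq_neg.2 (hL _ w)).symm
      _ = B (-L (B'.symm K)) w := by rw [map_neg, _root_.neg_apply]
  have htrace := LinearMap.trace_transpose' (L : E →ₗ[ℝ] E)
  rw [hconj, LinearMap.trace_conj', map_neg] at htrace
  linarith

end Bilinear

section Gram

variable {n m : ℕ} {b : Eu n →L[ℝ] Eu n →L[ℝ] ℝ}

lemma sum_smul_e (v : Eu n) : ∑ i, v i • (e i : Eu n) = v := by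
  simpa [e] using (EuclideanSpace.basisFun (Fin n) ℝ).sum_repr v

lemma trace_eq_sum (L : Eu n →L[ℝ] Eu n) : LinearMap.trace ℝ (Eu n) L = ∑ i, L (e i) i := by
  rw [LinearMap.trace_eq_matrix_trace ℝ (EuclideanSpace.basisFun (Fin n) ℝ).toBasis]
  simp [Matrix.trace, LinearMap.toMatrix_apply, e]

lemma gram_mulVec (hs : ∀ v w, b v w = b w v) (x : Eu n) :
    Matrix.mulVec (gram fun v w => b v w) x = fun i => b x (e i) := by
  funext i
  conv_rhs => rw [hs, ← sum_smul_e x]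
  simp [Matrix.mulVec, dotProduct, gram, mul_comm]

lemma isUnit_gram (hs : ∀ v w, b v w = b w v) (hb : b.IsInvertible) :
    IsUnit (gram fun v w => b v w) := by
  refine Matrix.mulVec_injective_iff_isUnit.1 fun x y hxy => ?_
  refine congrArg WithLp.ofLp
    (eq_of_forall_apply_eq hb (v := WithLp.toLp 2 x) (w := WithLp.toLp 2 y) fun w => ?_)
  have hbasis : ∀ i, b (WithLp.toLp 2 x) (e i) = b (WithLp.toLp 2 y) (e i) := fun i => by
    simpa only [gram_mulVec hs (WithLp.toLp 2 x), gram_mulVec hs (WithLp.toLp 2 y)]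
      using congrFun hxy i
  rw [← sum_smul_e w]
  simp only [map_sum, map_smul, hbasis]

lemma sum_gram_inv_mul (hs : ∀ v w, b v w = b w v) (hb : b.IsInvertible) (x : Eu n) (i : Fin n) :
    ∑ j, (gram fun v w => b v w)⁻¹ i j * b x (e j) = x i := by
  have hdet := (Matrix.isUnit_iff_isUnit_det _).1 (isUnit_gram hs hb)
  have hinv : Matrix.mulVec (gram fun v w => b v w)⁻¹
      (Matrix.mulVec (gram fun v w => b v w) x) = x := by
    rw [Matrix.mulVec_mulVec, Matrix.nonsing_inv_mul _ hdet, Matrix.one_mulVec]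
  rw [gram_mulVec hs] at hinv
  exact congrFun hinv i

lemma toLp_sum_gram_inv_mul (hs : ∀ v w, b v w = b w v) (hb : b.IsInvertible)
    (K : Eu n →L[ℝ] ℝ) :
    WithLp.toLp 2 (fun i => ∑ j, (gram fun v w => b v w)⁻¹ i j * K (e j)) = b.inverse K := by
  ext i
  simpa only [hb.self_apply_inverse] using sum_gram_inv_mul hs hb (b.inverse K) i

lemma apply_traceWrt_eq_trace (hs : ∀ v w, b v w = b w v) (hb : b.IsInvertible)
    {T : Eu n → Eu n → Eu m} {K : Eu m →L[ℝ] ℝ} {L : Eu n →L[ℝ] Eu n}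
    (h : ∀ v w, K (T v w) = b (L v) w) :
    K (traceWrt (fun v w => b v w) T) = LinearMap.trace ℝ (Eu n) L := by
  rw [trace_eq_sum]
  simp only [traceWrt, map_sum, map_smul, smul_eq_mul, h, sum_gram_inv_mul hs hb]

end Gram

section Calculus

variable {E X F : Type*} [NormedAddCommGroup E] [NormedSpace ℝ E]
  [NormedAddCommGroup X] [NormedSpace ℝ X] [NormedAddCommGroup F] [NormedSpace ℝ F]

lemma fderiv_clm_apply_apply {A : X → E →L[ℝ] F} {Z : X → E} {u : X} (hA : DifferentiableAt ℝ A u)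
    (hZ : DifferentiableAt ℝ Z u) (v : X) :
    fderiv ℝ (fun t => A t (Z t)) u v = fderiv ℝ A u v (Z u) + A u (fderiv ℝ Z u v) := by
  simp only [fderiv_clm_apply hA hZ, _root_.add_apply, ContinuousLinearMap.comp_apply,
    ContinuousLinearMap.flip_apply, add_comm]

lemma fderiv_linear_along {B : E → E →L[ℝ] F} {f Z : X → E} {u : X}
    (hB : DifferentiableAt ℝ B (f u)) (hf : DifferentiableAt ℝ f u)
    (hZ : DifferentiableAt ℝ Z u) (v : X) :
    fderiv ℝ (fun t => B (f t) (Z t)) u v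
      = fderiv ℝ B (f u) (fderiv ℝ f u v) (Z u) + B (f u) (fderiv ℝ Z u v) := by
  rw [fderiv_clm_apply_apply (A := fun t => B (f t)) (hB.comp u hf) hZ,
    fderiv_fun_comp u hB hf, ContinuousLinearMap.comp_apply]

lemma fderiv_bilin_along {B : E → E →L[ℝ] E →L[ℝ] F} {f Z W : X → E} {u : X}
    (hB : DifferentiableAt ℝ B (f u)) (hf : DifferentiableAt ℝ f u)
    (hZ : DifferentiableAt ℝ Z u) (hW : DifferentiableAt ℝ W u) (v : X) :
    fderiv ℝ (fun t => B (f t) (Z t) (W t)) u v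
      = fderiv ℝ B (f u) (fderiv ℝ f u v) (Z u) (W u) + B (f u) (fderiv ℝ Z u v) (W u)
        + B (f u) (Z u) (fderiv ℝ W u v) := by
  have hBZ : DifferentiableAt ℝ (fun t => B (f t) (Z t)) u :=
    DifferentiableAt.clm_apply (c := fun t => B (f t)) (hB.comp u hf) hZ
  rw [fderiv_clm_apply_apply hBZ hW, fderiv_linear_along hB hf hZ, _root_.add_apply]

lemma fderiv_bilin_const {B : X → E →L[ℝ] E →L[ℝ] F} {u : X} (hB : DifferentiableAt ℝ B u)
    (v : X) (a b : E) : fderiv ℝ (fun t => B t a b) u v = fderiv ℝ B u v a b := by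
  have hBa : DifferentiableAt ℝ (fun t => B t a) u := hB.clm_apply (differentiableAt_const a)
  simpa [fderiv_clm_apply_apply hB (differentiableAt_const a)] using
    fderiv_clm_apply_apply hBa (differentiableAt_const b) v

lemma eventually_differentiableAt {Z : X → F} {u : X} (hZ : ContDiffAt ℝ ∞ Z u) :
    ∀ᶠ t in nhds u, DifferentiableAt ℝ Z t := by
  have hZ' : ContDiffAt ℝ 1 Z u := hZ.of_le (by simp)
  filter_upwards [hZ'.eventually (by simp)] with t ht using ht.differentiableAt (by simp)

lemma contDiffAt_fderiv {Z : X → F} {u : X} (hZ : ContDiffAt ℝ ∞ Z u) :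
    ContDiffAt ℝ ∞ (fderiv ℝ Z) u :=
  hZ.fderiv_right (by simp)

lemma differentiableAt_fderiv {Z : X → F} {u : X} (hZ : ContDiffAt ℝ ∞ Z u) :
    DifferentiableAt ℝ (fderiv ℝ Z) u :=
  (contDiffAt_fderiv hZ).differentiableAt (by simp)

lemma fderiv_fderiv_symm {Z : X → F} {u : X} (hZ : ContDiffAt ℝ ∞ Z u) (v w : X) :
    fderiv ℝ (fderiv ℝ Z) u v w = fderiv ℝ (fderiv ℝ Z) u w v :=
  (hZ.isSymmSndFDerivAt (by simpa using WithTop.coe_le_coe.2 (le_top : (2 : ℕ∞) ≤ ⊤))).eq v w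

end Calculus

section Connection

variable {E : Type*} [NormedAddCommGroup E] [NormedSpace ℝ E] {U : Set E}
  {g : E → E →L[ℝ] E →L[ℝ] ℝ} {Γ : E → E →L[ℝ] E →L[ℝ] E} {y : E}

/-- `g` is a smooth, possibly indefinite, metric on the open set `U`. -/
structure IsPseudoMetric (U : Set E) (g : E → E →L[ℝ] E →L[ℝ] ℝ) : Prop where
  isOpen : IsOpen U
  smooth : ContDiffOn ℝ ∞ g U
  symm : ∀ y ∈ U, ∀ v w, g y v w = g y w v
  isInvertible : ∀ y ∈ U, (g y).IsInvertible

/-- `Γ` consists of the Christoffel symbols `Γ y v w = ∇_v w` (for constant fields `v`, `w`) of the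
Levi-Civita connection of `g` on `U`: it is smooth, torsion-free and metric. -/
structure IsLeviCivita (U : Set E) (g : E → E →L[ℝ] E →L[ℝ] ℝ) (Γ : E → E →L[ℝ] E →L[ℝ] E) :
    Prop where
  smooth : ContDiffOn ℝ ∞ Γ U
  torsion_free : ∀ y ∈ U, ∀ v w, Γ y v w = Γ y w v
  metric : ∀ y ∈ U, ∀ u v w, fderiv ℝ g y u v w = g y (Γ y u v) w + g y v (Γ y u w)

/-- Christoffel symbols of the first kind: the right-hand side of the Koszul formula for
`g(∇_v w, x)`, with constant fields `v`, `w`, `x`. -/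
def koszul (g : E → E →L[ℝ] E →L[ℝ] ℝ) (y : E) : E →L[ℝ] E →L[ℝ] E →L[ℝ] ℝ :=
  (1 / 2 : ℝ) • (fderiv ℝ g y + (fderiv ℝ g y).flip
    - ((ContinuousLinearMap.flipₗᵢ ℝ E E ℝ : _ →L[ℝ] E →L[ℝ] E →L[ℝ] ℝ).comp
        (fderiv ℝ g y).flip))

lemma koszul_apply (v w x : E) : koszul g y v w x
    = 1 / 2 * (fderiv ℝ g y v w x + fderiv ℝ g y w v x - fderiv ℝ g y x v w) := rfl

/-- The Christoffel symbols obtained by raising an index of `koszul`. -/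
def leviCivita (g : E → E →L[ℝ] E →L[ℝ] ℝ) (y : E) : E →L[ℝ] E →L[ℝ] E :=
  (ContinuousLinearMap.compL ℝ E (E →L[ℝ] ℝ) E (g y).inverse).comp (koszul g y)

lemma leviCivita_apply (v w : E) : leviCivita g y v w = (g y).inverse (koszul g y v w) := rfl

namespace IsLeviCivita

variable (hΓ : IsLeviCivita U g Γ) (hs : ∀ y ∈ U, ∀ v w, g y v w = g y w v)
include hΓ

lemma contDiffAt (hU : IsOpen U) (hy : y ∈ U) : ContDiffAt ℝ ∞ Γ y :=
  hΓ.smooth.contDiffAt (hU.mem_nhds hy)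

include hs in
lemma apply_eq_koszul (hy : y ∈ U) (v w x : E) : g y (Γ y v w) x = koszul g y v w x := by
  rw [koszul_apply, hΓ.metric y hy v, hΓ.metric y hy w, hΓ.metric y hy x,
    hΓ.torsion_free y hy w v, hΓ.torsion_free y hy x v, hΓ.torsion_free y hy x w,
    hs y hy w, hs y hy (Γ y v x)]
  ring

end IsLeviCivita

namespace IsPseudoMetric

variable (hg : IsPseudoMetric U g)
include hg

lemma contDiffAt (hy : y ∈ U) : ContDiffAt ℝ ∞ g y :=
  hg.smooth.contDiffAt (hg.isOpen.mem_nhds hy)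

lemma differentiableAt (hy : y ∈ U) : DifferentiableAt ℝ g y :=
  (hg.contDiffAt hy).differentiableAt (by simp)

lemma fderiv_apply_apply (hy : y ∈ U) (u v w : E) :
    fderiv ℝ (fun z => g z v w) y u = fderiv ℝ g y u v w :=
  fderiv_bilin_const (hg.differentiableAt hy) u v w

lemma fderiv_symm (hy : y ∈ U) (u v w : E) : fderiv ℝ g y u v w = fderiv ℝ g y u w v := by
  rw [← hg.fderiv_apply_apply hy, ← hg.fderiv_apply_apply hy]
  congr 1
  refine Filter.EventuallyEq.fderiv_eq ?_
  filter_upwards [hg.isOpen.mem_nhds hy] with z hz using hg.symm z hz v w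

lemma contDiffAt_koszul (hy : y ∈ U) : ContDiffAt ℝ ∞ (koszul g) y := by
  have hD := contDiffAt_fderiv (hg.contDiffAt hy)
  have hflip : ContDiffAt ℝ ∞ (fun z => (fderiv ℝ g z).flip) y :=
    (ContinuousLinearMap.flipₗᵢ ℝ E E (E →L[ℝ] ℝ)).contDiff.contDiffAt.comp y hD
  exact ((hD.add hflip).sub (contDiffAt_const.clm_comp hflip)).const_smul (1 / 2 : ℝ)

lemma contDiffAt_leviCivita [CompleteSpace E] (hy : y ∈ U) : ContDiffAt ℝ ∞ (leviCivita g) y :=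
  ((ContinuousLinearMap.compL ℝ E (E →L[ℝ] ℝ) E).contDiff.contDiffAt.comp y
    ((hg.isInvertible y hy).contDiffAt_map_inverse.comp y (hg.contDiffAt hy))).clm_comp
      (hg.contDiffAt_koszul hy)

theorem isLeviCivita [CompleteSpace E] : IsLeviCivita U g (leviCivita g) where
  smooth _ hy := (hg.contDiffAt_leviCivita hy).contDiffWithinAt
  torsion_free y hy v w := by
    rw [leviCivita_apply, leviCivita_apply]
    congr 1
    ext x
    rw [koszul_apply, koszul_apply, hg.fderiv_symm hy x v w]
    ring
  metric y hy u v w := by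
    rw [hg.symm y hy v, leviCivita_apply, leviCivita_apply,
      (hg.isInvertible y hy).self_apply_inverse, (hg.isInvertible y hy).self_apply_inverse,
      koszul_apply, koszul_apply, hg.fderiv_symm hy u w v, hg.fderiv_symm hy w u v,
      hg.fderiv_symm hy v u w]
    ring

end IsPseudoMetric

end Connection

section CovariantDerivative

variable {E X : Type*} [NormedAddCommGroup E] [NormedSpace ℝ E]
  [NormedAddCommGroup X] [NormedSpace ℝ X] {Γ : E → E →L[ℝ] E →L[ℝ] E} {f Z : X → E} {u : X}

/-- The covariant derivative `v ↦ ∇_v Z` at `u` of a field `Z` along the map `f`, for the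
pull-back of the connection with Christoffel symbols `Γ`. -/
def covDeriv (Γ : E → E →L[ℝ] E →L[ℝ] E) (f Z : X → E) (u : X) : X →L[ℝ] E :=
  fderiv ℝ Z u + ((Γ (f u)).comp (fderiv ℝ f u)).flip (Z u)

/-- The curvature `R(u, v) w = ∇_u ∇_v w - ∇_v ∇_u w` (for constant fields `u`, `v`, `w`) of the
connection with Christoffel symbols `Γ`. -/
def curv (Γ : E → E →L[ℝ] E →L[ℝ] E) (y u v w : E) : E :=
  (fderiv ℝ Γ y u v w + Γ y u (Γ y v w)) - (fderiv ℝ Γ y v u w + Γ y v (Γ y u w))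

lemma covDeriv_apply (v : X) :
    covDeriv Γ f Z u v = fderiv ℝ Z u v + Γ (f u) (fderiv ℝ f u v) (Z u) := rfl

lemma covDeriv_congr (Γ : E → E →L[ℝ] E →L[ℝ] E) (f : X → E) {W : X → E}
    (h : Z =ᶠ[nhds u] W) : covDeriv Γ f Z u = covDeriv Γ f W u := by
  rw [covDeriv, covDeriv, h.fderiv_eq, h.eq_of_nhds]

lemma contDiffAt_covDeriv (hΓ : ContDiffAt ℝ ∞ Γ (f u)) (hf : ContDiffAt ℝ ∞ f u)
    (hZ : ContDiffAt ℝ ∞ Z u) : ContDiffAt ℝ ∞ (covDeriv Γ f Z) u := by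
  have hflip : ContDiffAt ℝ ∞ (fun t => ((Γ (f t)).comp (fderiv ℝ f t)).flip) u :=
    (ContinuousLinearMap.flipₗᵢ ℝ X E E).contDiff.contDiffAt.comp u
      ((hΓ.comp u hf).clm_comp (contDiffAt_fderiv hf))
  exact (contDiffAt_fderiv hZ).add (hflip.clm_apply hZ)

lemma covDeriv_smul {h : X → ℝ} (hh : DifferentiableAt ℝ h u) (hZ : DifferentiableAt ℝ Z u)
    (v : X) :
    covDeriv Γ f (fun t => h t • Z t) u v = fderiv ℝ h u v • Z u + h u • covDeriv Γ f Z u v := by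
  simp only [covDeriv_apply, fderiv_fun_smul hh hZ, _root_.add_apply, _root_.smul_apply,
    ContinuousLinearMap.smulRight_apply, map_smul]
  module

lemma covDeriv_covDeriv_apply {w : X → X} (hΓ : ContDiffAt ℝ ∞ Γ (f u)) (hf : ContDiffAt ℝ ∞ f u)
    (hZ : ContDiffAt ℝ ∞ Z u) (hw : DifferentiableAt ℝ w u) (v : X) :
    covDeriv Γ f (fun t => covDeriv Γ f Z t (w t)) u v
      = covDeriv Γ f (fun t => covDeriv Γ f Z t (w u)) u v
        + covDeriv Γ f Z u (fderiv ℝ w u v) := by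
  have hd := (contDiffAt_covDeriv hΓ hf hZ).differentiableAt (by simp)
  rw [covDeriv_apply, covDeriv_apply (Z := fun t => covDeriv Γ f Z t (w u)),
    fderiv_clm_apply_apply hd hw, fderiv_clm_apply_apply hd (differentiableAt_const (w u))]
  simp only [fderiv_fun_const, Pi.zero_apply, _root_.zero_apply, map_zero]
  abel

lemma fderiv_fderiv_apply {W : X → E} (hW : ContDiffAt ℝ ∞ W u) (v w : X) :
    fderiv ℝ (fun t => fderiv ℝ W t w) u v = fderiv ℝ (fderiv ℝ W) u v w := by
  simpa using fderiv_clm_apply_apply (differentiableAt_fderiv hW) (differentiableAt_const w) v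

lemma covDeriv_fderiv_symm (ht : ∀ a b, Γ (f u) a b = Γ (f u) b a) (hf : ContDiffAt ℝ ∞ f u)
    (v w : X) :
    covDeriv Γ f (fun t => fderiv ℝ f t w) u v = covDeriv Γ f (fun t => fderiv ℝ f t v) u w := by
  rw [covDeriv_apply, covDeriv_apply, fderiv_fderiv_apply hf, fderiv_fderiv_apply hf,
    fderiv_fderiv_symm hf, ht]

lemma covDeriv_covDeriv_eq (hΓ : ContDiffAt ℝ ∞ Γ (f u)) (hf : ContDiffAt ℝ ∞ f u)
    (hZ : ContDiffAt ℝ ∞ Z u) (v w : X) :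
    covDeriv Γ f (fun t => covDeriv Γ f Z t w) u v
      = fderiv ℝ (fderiv ℝ Z) u v w + Γ (f u) (fderiv ℝ (fderiv ℝ f) u v w) (Z u)
        + Γ (f u) (fderiv ℝ f u w) (fderiv ℝ Z u v) + Γ (f u) (fderiv ℝ f u v) (fderiv ℝ Z u w)
        + (fderiv ℝ Γ (f u) (fderiv ℝ f u v) (fderiv ℝ f u w) (Z u)
          + Γ (f u) (fderiv ℝ f u v) (Γ (f u) (fderiv ℝ f u w) (Z u))) := by
  have dΓ := hΓ.differentiableAt (by simp)
  have df := hf.differentiableAt (by simp)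
  have dZ := hZ.differentiableAt (by simp)
  have dfw : DifferentiableAt ℝ (fun t => fderiv ℝ f t w) u :=
    (differentiableAt_fderiv hf).clm_apply (differentiableAt_const w)
  have dZw : DifferentiableAt ℝ (fun t => fderiv ℝ Z t w) u :=
    (differentiableAt_fderiv hZ).clm_apply (differentiableAt_const w)
  have dΓfw : DifferentiableAt ℝ (fun t => Γ (f t) (fderiv ℝ f t w) (Z t)) u :=
    (DifferentiableAt.clm_apply (c := fun t => Γ (f t)) (dΓ.comp u df) dfw).clm_apply dZ
  simp only [covDeriv_apply]
  rw [fderiv_fun_add dZw dΓfw, _root_.add_apply, fderiv_fderiv_apply hZ,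
    fderiv_bilin_along dΓ df dfw dZ, fderiv_fderiv_apply hf, map_add]
  abel

lemma covDeriv_comm (hΓ : ContDiffAt ℝ ∞ Γ (f u)) (hf : ContDiffAt ℝ ∞ f u)
    (hZ : ContDiffAt ℝ ∞ Z u) (v w : X) :
    covDeriv Γ f (fun t => covDeriv Γ f Z t w) u v
      = covDeriv Γ f (fun t => covDeriv Γ f Z t v) u w
        + curv Γ (f u) (fderiv ℝ f u v) (fderiv ℝ f u w) (Z u) := by
  rw [covDeriv_covDeriv_eq hΓ hf hZ, covDeriv_covDeriv_eq hΓ hf hZ, fderiv_fderiv_symm hZ v w,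
    fderiv_fderiv_symm hf v w, curv]
  abel

lemma IsLeviCivita.fderiv_inner {U : Set E} {g : E → E →L[ℝ] E →L[ℝ] ℝ}
    (hΓ : IsLeviCivita U g Γ) (hg : IsPseudoMetric U g) (hu : f u ∈ U) {W : X → E}
    (hf : DifferentiableAt ℝ f u) (hZ : DifferentiableAt ℝ Z u) (hW : DifferentiableAt ℝ W u)
    (v : X) :
    fderiv ℝ (fun t => g (f t) (Z t) (W t)) u v
      = g (f u) (covDeriv Γ f Z u v) (W u) + g (f u) (Z u) (covDeriv Γ f W u v) := by
  rw [fderiv_bilin_along (hg.differentiableAt hu) hf hZ hW, hΓ.metric _ hu]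
  simp only [covDeriv_apply, map_add, _root_.add_apply]
  ring

end CovariantDerivative

section Christoffel

variable {n k : ℕ} {U : Set (Eu n)} {g : Eu n → Eu n →L[ℝ] Eu n →L[ℝ] ℝ}
  {Γ : Eu n → Eu n →L[ℝ] Eu n →L[ℝ] Eu n} {G : Eu n → Eu n → Eu n → ℝ}

theorem christoffel_eq (hΓ : IsLeviCivita U g Γ) (hg : IsPseudoMetric U g)
    (hG : ∀ y ∈ U, ∀ v w, G y v w = g y v w) {y : Eu n} (hy : y ∈ U) (v w : Eu n) :
    christoffel G y v w = Γ y v w := by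
  have hfderiv : ∀ a b x, fderiv ℝ (fun z => G z a b) y x = fderiv ℝ g y x a b := by
    intro a b x
    rw [← hg.fderiv_apply_apply hy]
    congr 1
    refine Filter.EventuallyEq.fderiv_eq ?_
    filter_upwards [hg.isOpen.mem_nhds hy] with z hz using hG z hz a b
  have hgram : gram (G y) = gram fun v w => g y v w := by
    simp only [gram, hG y hy]
  have hΓg : Γ y v w = (g y).inverse (koszul g y v w) :=
    ((hg.isInvertible y hy).inverse_apply_eq.2
      (ContinuousLinearMap.ext fun x => (hΓ.apply_eq_koszul hg.symm hy v w x).symm)).symm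
  rw [hΓg, ← toLp_sum_gram_inv_mul (hg.symm y hy) (hg.isInvertible y hy)]
  simp only [christoffel, hfderiv, hgram, koszul_apply]

lemma riemann_eq_curv (hU : IsOpen U) (hΓ : ContDiffOn ℝ ∞ Γ U)
    (h : ∀ y ∈ U, ∀ v w, christoffel G y v w = Γ y v w) {y : Eu n} (hy : y ∈ U) (u v w : Eu n) :
    riemann G y u v w = curv Γ y u v w := by
  have dΓ : DifferentiableAt ℝ Γ y := (hΓ.contDiffAt (hU.mem_nhds hy)).differentiableAt (by simp)
  have hfderiv : ∀ a b, fderiv ℝ (fun z => christoffel G z a w) y b = fderiv ℝ Γ y b a w := by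
    intro a b
    have heq : (fun z => christoffel G z a w) =ᶠ[nhds y] fun z => Γ z a w := by
      filter_upwards [hU.mem_nhds hy] with z hz using h z hz a w
    rw [heq.fderiv_eq, fderiv_bilin_const dΓ]
  simp only [riemann, cov, curv, hfderiv, h y hy]

lemma covAlong_eq_covDeriv (h : ∀ y ∈ U, ∀ v w, christoffel G y v w = Γ y v w)
    {f Z : Eu k → Eu n} {u : Eu k} (hu : f u ∈ U) (v : Eu k) :
    covAlong G f Z u v = covDeriv Γ f Z u v := by
  rw [covAlong, covDeriv_apply, h _ hu]

end Christoffel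

end Coord

/-! ### Sasakian structures -/

open Coord

section Sasakian

variable {E X : Type*} [NormedAddCommGroup E] [NormedSpace ℝ E]
  [NormedAddCommGroup X] [NormedSpace ℝ X]

/-- A Sasakian structure `(φ, ξ, η, g)` on the open set `U`, with `η = g(ξ, ·)` and with `Γ` the
Christoffel symbols of `g`. -/
structure SasakianChart (U : Set E) (g : E → E →L[ℝ] E →L[ℝ] ℝ) (Γ : E → E →L[ℝ] E →L[ℝ] E)
    (φ : E → E →L[ℝ] E) (ξ : E → E) : Prop where
  isOpen : IsOpen U
  smooth_g : ContDiffOn ℝ ∞ g U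
  smooth_φ : ContDiffOn ℝ ∞ φ U
  smooth_ξ : ContDiffOn ℝ ∞ ξ U
  symm : ∀ y ∈ U, ∀ v w, g y v w = g y w v
  pos : ∀ y ∈ U, ∀ v, v ≠ 0 → 0 < g y v v
  unit_ξ : ∀ y ∈ U, g y (ξ y) (ξ y) = 1
  φ_ξ : ∀ y ∈ U, φ y (ξ y) = 0
  φ_sq : ∀ y ∈ U, ∀ v, φ y (φ y v) = -v + g y (ξ y) v • ξ y
  g_φ : ∀ y ∈ U, ∀ v w, g y (φ y v) (φ y w) = g y v w - g y (ξ y) v * g y (ξ y) w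
  isLeviCivita : IsLeviCivita U g Γ
  cov_φ : ∀ y ∈ U, ∀ v w,
    fderiv ℝ φ y v w + Γ y v (φ y w) - φ y (Γ y v w) = g y v w • ξ y - g y (ξ y) w • v

/-- The symmetric bilinear form `a g + b η ⊗ η`, with `η = g(ξ, ·)`; the Ricci tensor of a Sasakian
space form is of this kind. -/
def ηDeformation (g : E → E →L[ℝ] E →L[ℝ] ℝ) (ξ : E → E) (a b : ℝ) (y : E) : E →L[ℝ] E →L[ℝ] ℝ :=
  a • g y + b • (g y (ξ y)).smulRight (g y (ξ y))

/-- The connection `∇ - κ (η ⊗ φ + φ ⊗ η)`, with `η = g(ξ, ·)`; for `κ = b / a` it is the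
Levi-Civita connection of `a g + b η ⊗ η`. -/
def deformedConnection (g : E → E →L[ℝ] E →L[ℝ] ℝ) (Γ : E → E →L[ℝ] E →L[ℝ] E) (φ : E → E →L[ℝ] E)
    (ξ : E → E) (κ : ℝ) (y : E) : E →L[ℝ] E →L[ℝ] E :=
  Γ y - κ • ((g y (ξ y)).smulRight (φ y) + ((g y (ξ y)).smulRight (φ y)).flip)

variable {U : Set E} {g : E → E →L[ℝ] E →L[ℝ] ℝ} {Γ : E → E →L[ℝ] E →L[ℝ] E} {φ : E → E →L[ℝ] E}
  {ξ : E → E} {κ : ℝ} {f Z : X → E} {u : X} {y : E}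

lemma ηDeformation_apply (a b : ℝ) (v w : E) :
    ηDeformation g ξ a b y v w = a * g y v w + b * (g y (ξ y) v * g y (ξ y) w) := rfl

lemma deformedConnection_apply (v w : E) :
    deformedConnection g Γ φ ξ κ y v w
      = Γ y v w - κ • (g y (ξ y) v • φ y w + g y (ξ y) w • φ y v) := rfl

lemma covDeriv_deformedConnection (v : X) :
    covDeriv (deformedConnection g Γ φ ξ κ) f Z u v = covDeriv Γ f Z u v
      - κ • (g (f u) (ξ (f u)) (fderiv ℝ f u v) • φ (f u) (Z u)
        + g (f u) (ξ (f u)) (Z u) • φ (f u) (fderiv ℝ f u v)) := by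
  rw [covDeriv_apply, covDeriv_apply, deformedConnection_apply]
  abel

namespace SasakianChart

variable (S : SasakianChart U g Γ φ ξ)
include S

lemma isPseudoMetric [FiniteDimensional ℝ E] : IsPseudoMetric U g where
  isOpen := S.isOpen
  smooth := S.smooth_g
  symm := S.symm
  isInvertible y hy := isInvertible_of_pos (S.pos y hy)

lemma contDiffAt_φ (hy : y ∈ U) : ContDiffAt ℝ ∞ φ y :=
  S.smooth_φ.contDiffAt (S.isOpen.mem_nhds hy)

lemma contDiffAt_ξ (hy : y ∈ U) : ContDiffAt ℝ ∞ ξ y :=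
  S.smooth_ξ.contDiffAt (S.isOpen.mem_nhds hy)

lemma contDiffOn_η : ContDiffOn ℝ ∞ (fun y => g y (ξ y)) U :=
  S.smooth_g.clm_apply S.smooth_ξ

lemma η_φ (hy : y ∈ U) (v : E) : g y (ξ y) (φ y v) = 0 := by
  have h := S.φ_sq y hy (φ y v)
  rw [S.φ_sq y hy v, map_add, map_neg, map_smul, S.φ_ξ y hy, smul_zero, add_zero] at h
  simpa [S.unit_ξ y hy] using congrArg (g y (ξ y)) (left_eq_add.1 h)

lemma skew (hy : y ∈ U) (v w : E) : g y (φ y v) w = -g y v (φ y w) := by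
  have h := S.g_φ y hy v (φ y w)
  rw [S.φ_sq y hy w, S.η_φ hy, map_add, map_neg, map_smul, S.symm y hy _ (ξ y), S.η_φ hy,
    smul_zero, add_zero, mul_zero, sub_zero] at h
  rw [← h, neg_neg]

lemma g_φ_self (hy : y ∈ U) (v : E) : g y (φ y v) v = 0 := by
  have h := S.skew hy v v
  rw [S.symm y hy v] at h
  linarith

lemma fderiv_inner [FiniteDimensional ℝ E] (hu : f u ∈ U) {W : X → E}
    (hf : DifferentiableAt ℝ f u) (hZ : DifferentiableAt ℝ Z u) (hW : DifferentiableAt ℝ W u)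
    (v : X) :
    fderiv ℝ (fun t => g (f t) (Z t) (W t)) u v
      = g (f u) (covDeriv Γ f Z u v) (W u) + g (f u) (Z u) (covDeriv Γ f W u v) :=
  S.isLeviCivita.fderiv_inner S.isPseudoMetric hu hf hZ hW v

lemma η_cov_ξ [FiniteDimensional ℝ E] (hy : y ∈ U) (v : E) :
    g y (ξ y) (fderiv ℝ ξ y v + Γ y v (ξ y)) = 0 := by
  have dξ := (S.contDiffAt_ξ hy).differentiableAt (by simp)
  have hconst : (fun z => g z (ξ z) (ξ z)) =ᶠ[nhds y] fun _ => 1 := by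
    filter_upwards [S.isOpen.mem_nhds hy] with z hz using S.unit_ξ z hz
  have h := S.fderiv_inner (f := fun z => z) hy differentiableAt_id dξ dξ v
  rw [hconst.fderiv_eq, fderiv_fun_const, Pi.zero_apply, _root_.zero_apply,
    S.symm y hy (covDeriv _ _ _ _ _), covDeriv_apply, fderiv_fun_id,
    ContinuousLinearMap.id_apply] at h
  linarith

lemma φ_cov_ξ (hy : y ∈ U) (v : E) :
    φ y (fderiv ℝ ξ y v + Γ y v (ξ y)) = v - g y v (ξ y) • ξ y := by
  have dφ := (S.contDiffAt_φ hy).differentiableAt (by simp)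
  have dξ := (S.contDiffAt_ξ hy).differentiableAt (by simp)
  have hzero : (fun z => φ z (ξ z)) =ᶠ[nhds y] fun _ => 0 := by
    filter_upwards [S.isOpen.mem_nhds hy] with z hz using S.φ_ξ z hz
  have h := fderiv_clm_apply_apply dφ dξ v
  rw [hzero.fderiv_eq, fderiv_fun_const, Pi.zero_apply, _root_.zero_apply] at h
  have hcov := S.cov_φ y hy v (ξ y)
  rw [S.φ_ξ y hy, map_zero, add_zero, S.unit_ξ y hy, one_smul,
    eq_neg_of_add_eq_zero_left h.symm] at hcov
  rw [map_add, ← neg_inj, neg_sub, ← hcov]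
  abel

/-- A vector is determined by its images under `φ` and `η`. -/
lemma cov_ξ [FiniteDimensional ℝ E] (hy : y ∈ U) (v : E) :
    fderiv ℝ ξ y v + Γ y v (ξ y) = -φ y v := by
  have h := S.φ_sq y hy (fderiv ℝ ξ y v + Γ y v (ξ y))
  rw [S.φ_cov_ξ hy, S.η_cov_ξ hy, zero_smul, add_zero, map_sub, map_smul, S.φ_ξ y hy, smul_zero,
    sub_zero] at h
  rw [h, neg_neg]

lemma differentiableAt_ξ_along (hu : f u ∈ U) (hf : DifferentiableAt ℝ f u) :
    DifferentiableAt ℝ (fun t => ξ (f t)) u :=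
  ((S.contDiffAt_ξ hu).differentiableAt (by simp)).comp u hf

lemma covDeriv_ξ [FiniteDimensional ℝ E] (hu : f u ∈ U) (hf : DifferentiableAt ℝ f u) (v : X) :
    covDeriv Γ f (fun t => ξ (f t)) u v = -φ (f u) (fderiv ℝ f u v) := by
  rw [covDeriv_apply, fderiv_fun_comp u ((S.contDiffAt_ξ hu).differentiableAt (by simp)) hf,
    ContinuousLinearMap.comp_apply, S.cov_ξ hu]

lemma covDeriv_φ (hu : f u ∈ U) (hf : DifferentiableAt ℝ f u) (hZ : DifferentiableAt ℝ Z u)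
    (v : X) :
    covDeriv Γ f (fun t => φ (f t) (Z t)) u v = φ (f u) (covDeriv Γ f Z u v)
      + g (f u) (fderiv ℝ f u v) (Z u) • ξ (f u) - g (f u) (ξ (f u)) (Z u) • fderiv ℝ f u v := by
  rw [covDeriv_apply, fderiv_linear_along ((S.contDiffAt_φ hu).differentiableAt (by simp)) hf hZ,
    covDeriv_apply, map_add, add_sub_assoc, ← S.cov_φ _ hu (fderiv ℝ f u v) (Z u)]
  abel

lemma fderiv_η [FiniteDimensional ℝ E] (hu : f u ∈ U) (hf : DifferentiableAt ℝ f u)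
    (hZ : DifferentiableAt ℝ Z u) (v : X) :
    fderiv ℝ (fun t => g (f t) (ξ (f t)) (Z t)) u v
      = g (f u) (ξ (f u)) (covDeriv Γ f Z u v) - g (f u) (Z u) (φ (f u) (fderiv ℝ f u v)) := by
  rw [S.fderiv_inner hu hf (S.differentiableAt_ξ_along hu hf) hZ, S.covDeriv_ξ hu hf, map_neg,
    _root_.neg_apply, S.symm _ hu (φ _ _)]
  ring

lemma contDiffOn_deformedConnection (κ : ℝ) :
    ContDiffOn ℝ ∞ (deformedConnection g Γ φ ξ κ) U := by
  have hT : ContDiffOn ℝ ∞ (fun y => (g y (ξ y)).smulRight (φ y)) U :=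
    S.contDiffOn_η.smulRight S.smooth_φ
  exact S.isLeviCivita.smooth.sub
    ((hT.add ((ContinuousLinearMap.flipₗᵢ ℝ E E E).contDiff.comp_contDiffOn hT)).const_smul κ)

lemma fderiv_η_const [FiniteDimensional ℝ E] (hy : y ∈ U) (u v : E) :
    fderiv ℝ (fun z => g z (ξ z) v) y u = g y (ξ y) (Γ y u v) - g y v (φ y u) := by
  have h := S.fderiv_η (f := fun z => z) hy differentiableAt_id (differentiableAt_const v) u
  rwa [covDeriv_apply, fderiv_fun_const, fderiv_fun_id, Pi.zero_apply, _root_.zero_apply, zero_add,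
    ContinuousLinearMap.id_apply] at h

lemma contDiffOn_ηDeformation (a b : ℝ) : ContDiffOn ℝ ∞ (ηDeformation g ξ a b) U :=
  (S.smooth_g.const_smul a).add ((S.contDiffOn_η.smulRight S.contDiffOn_η).const_smul b)

lemma fderiv_ηDeformation [FiniteDimensional ℝ E] (a b : ℝ) (hy : y ∈ U) (u v w : E) :
    fderiv ℝ (ηDeformation g ξ a b) y u v w = a * (g y (Γ y u v) w + g y v (Γ y u w))
      + b * ((g y (ξ y) (Γ y u v) - g y v (φ y u)) * g y (ξ y) w
        + g y (ξ y) v * (g y (ξ y) (Γ y u w) - g y w (φ y u))) := by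
  have hyU := S.isOpen.mem_nhds hy
  have dr := ((S.contDiffOn_ηDeformation a b).contDiffAt hyU).differentiableAt (by simp)
  have dg := S.isPseudoMetric.differentiableAt hy
  have dgvw : DifferentiableAt ℝ (fun z => g z v w) y :=
    (dg.clm_apply (differentiableAt_const v)).clm_apply (differentiableAt_const w)
  have dη : ∀ x, DifferentiableAt ℝ (fun z => g z (ξ z) x) y := fun x =>
    ((S.contDiffOn_η.contDiffAt hyU).differentiableAt (by simp)).clm_apply
      (differentiableAt_const x)
  rw [← fderiv_bilin_const dr]
  simp only [ηDeformation_apply]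
  rw [fderiv_fun_add (dgvw.const_mul a) (((dη v).fun_mul (dη w)).const_mul b),
    fderiv_const_mul dgvw, fderiv_const_mul ((dη v).fun_mul (dη w)), fderiv_fun_mul (dη v) (dη w)]
  simp only [_root_.add_apply, _root_.smul_apply, smul_eq_mul, S.fderiv_η_const hy,
    fderiv_bilin_const dg, S.isLeviCivita.metric y hy]
  ring

theorem isLeviCivita_ηDeformation [FiniteDimensional ℝ E] {a : ℝ} (ha : a ≠ 0) (b : ℝ) :
    IsLeviCivita U (ηDeformation g ξ a b) (deformedConnection g Γ φ ξ (b / a)) where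
  smooth := S.contDiffOn_deformedConnection _
  torsion_free y hy v w := by
    rw [deformedConnection_apply, deformedConnection_apply, S.isLeviCivita.torsion_free y hy,
      add_comm (g y (ξ y) v • φ y w)]
  metric y hy u v w := by
    have hb : b = a * (b / a) := (mul_div_cancel₀ b ha).symm
    rw [S.fderiv_ηDeformation a b hy]
    simp only [ηDeformation_apply, deformedConnection_apply, map_sub, map_add, map_smul,
      _root_.sub_apply, _root_.add_apply, _root_.smul_apply, smul_eq_mul, S.η_φ hy,
      S.symm y hy v (φ y _), S.symm y hy w (φ y _)]
    rw [S.skew hy v w, S.symm y hy v (φ y w)]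
    generalize b / a = κ at hb
    rw [hb]
    ring

/-- The terms in `κ` have no `ξ`-component, since `φ` takes its values in the kernel of `η`. -/
lemma η_covDeriv_deformedConnection [FiniteDimensional ℝ E] (hu : f u ∈ U)
    (hf : DifferentiableAt ℝ f u) (hZ : DifferentiableAt ℝ Z u) (v : X) :
    g (f u) (ξ (f u)) (covDeriv (deformedConnection g Γ φ ξ κ) f Z u v)
      = fderiv ℝ (fun t => g (f t) (ξ (f t)) (Z t)) u v
        + g (f u) (Z u) (φ (f u) (fderiv ℝ f u v)) := by
  rw [S.fderiv_η hu hf hZ, covDeriv_deformedConnection, map_sub, map_smul, map_add, map_smul,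
    map_smul, S.η_φ hu, S.η_φ hu]
  simp only [smul_zero, add_zero, sub_zero, sub_add_cancel]

lemma contDiffAt_η_along (hu : f u ∈ U) (hf : ContDiffAt ℝ ∞ f u)
    (hZ : ContDiffAt ℝ ∞ Z u) : ContDiffAt ℝ ∞ (fun t => g (f t) (ξ (f t)) (Z t)) u :=
  ContDiffAt.clm_apply (f := fun t => g (f t) (ξ (f t)))
    ((S.contDiffOn_η.contDiffAt (S.isOpen.mem_nhds hu)).comp u hf) hZ

lemma η_covDeriv_covDeriv_deformedConnection [FiniteDimensional ℝ E] (hu : f u ∈ U)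
    (hf : ContDiffAt ℝ ∞ f u) (hZ : ContDiffAt ℝ ∞ Z u) (v w : X) :
    g (f u) (ξ (f u)) (covDeriv (deformedConnection g Γ φ ξ κ) f
        (fun t => covDeriv (deformedConnection g Γ φ ξ κ) f Z t w) u v)
      = fderiv ℝ (fderiv ℝ fun t => g (f t) (ξ (f t)) (Z t)) u v w
        + g (f u) (covDeriv Γ f Z u v) (φ (f u) (fderiv ℝ f u w))
        + g (f u) (covDeriv Γ f Z u w) (φ (f u) (fderiv ℝ f u v))
        + g (f u) (Z u) (φ (f u) (covDeriv Γ f (fun t => fderiv ℝ f t w) u v))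
        + g (f u) (fderiv ℝ f u v) (fderiv ℝ f u w) * g (f u) (ξ (f u)) (Z u)
        - g (f u) (ξ (f u)) (fderiv ℝ f u w) * g (f u) (Z u) (fderiv ℝ f u v)
        - κ * (g (f u) (ξ (f u)) (fderiv ℝ f u w)
            * g (f u) (φ (f u) (Z u)) (φ (f u) (fderiv ℝ f u v))
          + g (f u) (ξ (f u)) (Z u)
            * g (f u) (φ (f u) (fderiv ℝ f u w)) (φ (f u) (fderiv ℝ f u v))) := by
  have df := hf.differentiableAt (by simp)
  have dZ := hZ.differentiableAt (by simp)
  have dfw : DifferentiableAt ℝ (fun t => fderiv ℝ f t w) u :=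
    (differentiableAt_fderiv hf).clm_apply (differentiableAt_const w)
  have dφfw : DifferentiableAt ℝ (fun t => φ (f t) (fderiv ℝ f t w)) u :=
    DifferentiableAt.clm_apply (c := fun t => φ (f t))
      (((S.contDiffAt_φ hu).differentiableAt (by simp)).comp u df) dfw
  have dηZ := S.contDiffAt_η_along hu hf hZ
  have dηZw : DifferentiableAt ℝ
      (fun t => fderiv ℝ (fun s => g (f s) (ξ (f s)) (Z s)) t w) u :=
    (differentiableAt_fderiv dηZ).clm_apply (differentiableAt_const w)
  have dgZφ : DifferentiableAt ℝ (fun t => g (f t) (Z t) (φ (f t) (fderiv ℝ f t w))) u :=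
    (DifferentiableAt.clm_apply (c := fun t => g (f t))
      ((S.isPseudoMetric.differentiableAt hu).comp u df) dZ).clm_apply dφfw
  have hcov := contDiffAt_covDeriv
    ((S.contDiffOn_deformedConnection κ).contDiffAt (S.isOpen.mem_nhds hu)) hf hZ
  have hη : (fun t => g (f t) (ξ (f t)) (covDeriv (deformedConnection g Γ φ ξ κ) f Z t w))
      =ᶠ[nhds u] fun t => fderiv ℝ (fun s => g (f s) (ξ (f s)) (Z s)) t w
        + g (f t) (Z t) (φ (f t) (fderiv ℝ f t w)) := by
    filter_upwards [hf.continuousAt.eventually (S.isOpen.mem_nhds hu),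
      eventually_differentiableAt hf, eventually_differentiableAt hZ] with t ht hft hZt
    exact S.η_covDeriv_deformedConnection ht hft hZt w
  rw [S.η_covDeriv_deformedConnection hu df
      ((hcov.differentiableAt (by simp)).clm_apply (differentiableAt_const w)), hη.fderiv_eq,
    fderiv_fun_add dηZw dgZφ, _root_.add_apply, fderiv_fderiv_apply dηZ,
    S.fderiv_inner hu df dZ dφfw, S.covDeriv_φ hu df dfw, covDeriv_deformedConnection]
  simp only [map_sub, map_add, map_smul, _root_.sub_apply, _root_.add_apply, _root_.smul_apply,
    smul_eq_mul, S.symm _ hu (Z u) (ξ (f u))]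
  ring

/-- Only the terms that are not symmetric in the two directions survive. -/
lemma η_curv_deformedConnection [FiniteDimensional ℝ E] (hy : y ∈ U) (u v w : E) :
    g y (ξ y) (curv (deformedConnection g Γ φ ξ κ) y u v w)
      = (1 + κ) * (g y (ξ y) u * g y v w - g y (ξ y) v * g y u w) := by
  have hcomm := covDeriv_comm (f := fun z => z) (Z := fun _ => w)
    ((S.contDiffOn_deformedConnection κ).contDiffAt (S.isOpen.mem_nhds hy)) contDiffAt_id
    contDiffAt_const u v
  have hη := S.η_covDeriv_covDeriv_deformedConnection (κ := κ) (f := fun z => z)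
    (Z := fun _ => w) hy contDiffAt_id contDiffAt_const
  have hsymm := fderiv_fderiv_symm
    (S.contDiffAt_η_along (f := fun z => z) (Z := fun _ => w) hy contDiffAt_id contDiffAt_const) u v
  have hcov := covDeriv_fderiv_symm (f := fun z => z) (S.isLeviCivita.torsion_free y hy)
    contDiffAt_id u v
  rw [← sub_eq_iff_eq_add'] at hcomm
  simp only [fderiv_fun_id, ContinuousLinearMap.id_apply] at hcomm hη hcov
  rw [← hcomm, map_sub, hη, hη, hsymm, hcov]
  rw [S.g_φ y hy, S.g_φ y hy, S.g_φ y hy, S.g_φ y hy, S.symm y hy w u, S.symm y hy w v,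
    S.symm y hy v u]
  ring

end SasakianChart

end Sasakian

/-! ### Sasakian space forms and their Ricci tensor -/

section SpaceForm

/-- A Sasakian structure of constant `φ`-sectional curvature `c` on the open set `U`. -/
structure SpaceFormChart {E : Type*} [NormedAddCommGroup E] [NormedSpace ℝ E] (U : Set E)
    (g : E → E →L[ℝ] E →L[ℝ] ℝ) (Γ : E → E →L[ℝ] E →L[ℝ] E) (φ : E → E →L[ℝ] E) (ξ : E → E)
    (c : ℝ) : Prop extends SasakianChart U g Γ φ ξ where
  curvature : ∀ y ∈ U, ∀ u v w, curv Γ y u v w =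
    (-((c - 1) / 4)) •
        (g y (ξ y) w • (g y (ξ y) v • u - g y (ξ y) u • v)
          + (g y v w * g y (ξ y) u - g y u w * g y (ξ y) v) • ξ y
          + g y (φ y u) w • φ y v
          + (2 * g y (φ y u) v) • φ y w
          - g y (φ y v) w • φ y u)
      + ((c + 3) / 4) • (g y v w • u - g y u w • v)

/-- The coefficient `a` in the formula `Ric = a g + b η ⊗ η` for the Ricci tensor of an
`n`-dimensional Sasakian space form of `φ`-sectional curvature `c`. -/
def ricciCoeff (n : ℕ) (c : ℝ) : ℝ := (c - 1) / 2 + (c + 3) * (n - 1) / 4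

/-- The coefficient `b` in the formula `Ric = a g + b η ⊗ η` for the Ricci tensor of an
`n`-dimensional Sasakian space form of `φ`-sectional curvature `c`. -/
def ricciCoeffη (n : ℕ) (c : ℝ) : ℝ := -((c - 1) * (n + 1) / 4)

namespace SpaceFormChart

lemma curv_ξ {E : Type*} [NormedAddCommGroup E] [NormedSpace ℝ E] {U : Set E}
    {g : E → E →L[ℝ] E →L[ℝ] ℝ} {Γ : E → E →L[ℝ] E →L[ℝ] E} {φ : E → E →L[ℝ] E} {ξ : E → E} {c : ℝ}
    (S : SpaceFormChart U g Γ φ ξ c) {y : E} (hy : y ∈ U) (v w : E) :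
    curv Γ y (ξ y) v w = g y v w • ξ y - g y (ξ y) w • v := by
  rw [S.curvature y hy, S.φ_ξ y hy, S.unit_ξ y hy]
  simp only [map_zero, _root_.zero_apply, zero_smul, mul_zero, smul_zero, sub_zero, add_zero]
  module

variable {n : ℕ} {U : Set (Eu n)} {g : Eu n → Eu n →L[ℝ] Eu n →L[ℝ] ℝ}
  {Γ : Eu n → Eu n →L[ℝ] Eu n →L[ℝ] Eu n} {φ : Eu n → Eu n →L[ℝ] Eu n} {ξ : Eu n → Eu n} {c : ℝ}
  (S : SpaceFormChart U g Γ φ ξ c) {G : Eu n → Eu n → Eu n → ℝ} {y : Eu n}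
include S

lemma sum_curv_apply (hy : y ∈ U) (v w : Eu n) :
    ∑ i, curv Γ y (e i) v w i = ηDeformation g ξ (ricciCoeff n c) (ricciCoeffη n c) y v w := by
  have hid : ∑ i : Fin n, (e i : Eu n) i = n := by simp [e]
  have hsum : ∀ (K : Eu n →L[ℝ] ℝ) x, ∑ i, K (e i) * x i = K x := fun K x => by
    conv_rhs => rw [← sum_smul_e x]
    simp only [map_sum, map_smul, smul_eq_mul, mul_comm]
  have hη : ∀ x, ∑ i, g y (ξ y) (e i) * x i = g y (ξ y) x := hsum (g y (ξ y))
  have hg : ∀ a x, ∑ i, g y (e i) a * x i = g y x a := fun a => hsum ((g y).flip a)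
  have hφ : ∀ a x, ∑ i, g y (φ y (e i)) a * x i = g y (φ y x) a := fun a =>
    hsum (((g y).flip a).comp (φ y))
  have htrace : ∑ i, φ y (e i) i = 0 := by
    rw [← trace_eq_sum, trace_eq_zero_of_skew (isInvertible_of_pos (S.pos y hy)) (S.skew hy)]
  have hterm : ∀ i, curv Γ y (e i) v w i
      = -((c - 1) / 4) * (g y (ξ y) w * g y (ξ y) v * (e i : Eu n) i
          - g y (ξ y) w * (g y (ξ y) (e i) * v i)
          + (g y v w * (g y (ξ y) (e i) * ξ y i) - g y (ξ y) v * (g y (e i) w * ξ y i))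
          + g y (φ y (e i)) w * φ y v i + 2 * (g y (φ y (e i)) v * φ y w i)
          - g y (φ y v) w * φ y (e i) i)
        + (c + 3) / 4 * (g y v w * (e i : Eu n) i - g y (e i) w * v i) := by
    intro i
    rw [S.curvature y hy]
    simp only [PiLp.add_apply, PiLp.smul_apply, PiLp.sub_apply, smul_eq_mul]
    ring
  simp only [hterm, Finset.sum_add_distrib, Finset.sum_sub_distrib, ← Finset.mul_sum, hid, hη, hg,
    hφ, htrace, S.φ_sq y hy, S.unit_ξ y hy, map_add, map_neg, map_smul, _root_.add_apply,
    _root_.neg_apply, _root_.smul_apply, smul_eq_mul, ηDeformation_apply, ricciCoeff, ricciCoeffη]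
  rw [S.symm y hy w v]
  ring

lemma ricci_eq (hG : ∀ y ∈ U, ∀ v w, G y v w = g y v w) (hy : y ∈ U) (v w : Eu n) :
    ricci G y v w = ηDeformation g ξ (ricciCoeff n c) (ricciCoeffη n c) y v w := by
  have hchristoffel : ∀ y ∈ U, ∀ v w, christoffel G y v w = Γ y v w := fun _ hz =>
    christoffel_eq S.isLeviCivita S.isPseudoMetric hG hz
  rw [← S.sum_curv_apply hy]
  simp only [ricci, riemann_eq_curv S.isOpen S.isLeviCivita.smooth hchristoffel hy]

/-- If `a = 0` then `Ric = b η ⊗ η` vanishes on the kernel of `η`. -/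
lemma ricciCoeff_ne_zero (hG : ∀ y ∈ U, ∀ v w, G y v w = g y v w) (hn : 2 ≤ n) (hy : y ∈ U)
    (hric : ∀ v, v ≠ 0 → ∃ w, ricci G y v w ≠ 0) : ricciCoeff n c ≠ 0 := by
  intro ha
  have hker : LinearMap.ker (g y (ξ y)).toLinearMap ≠ ⊥ :=
    LinearMap.ker_ne_bot_of_finrank_lt (by simpa using by omega)
  obtain ⟨v, hv, hv0⟩ := Submodule.exists_mem_ne_zero_of_ne_bot hker
  obtain ⟨w, hw⟩ := hric v hv0
  have hηv : g y (ξ y) v = 0 := hv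
  rw [S.ricci_eq hG hy, ηDeformation_apply, ha, hηv] at hw
  exact hw (by ring)

theorem christoffel_ricci_eq (hG : ∀ y ∈ U, ∀ v w, G y v w = g y v w) (hn : 2 ≤ n)
    (hric : ∀ y ∈ U, ∀ v, v ≠ 0 → ∃ w, ricci G y v w ≠ 0) (hy : y ∈ U) (v w : Eu n) :
    christoffel (ricci G) y v w
      = deformedConnection g Γ φ ξ (ricciCoeffη n c / ricciCoeff n c) y v w := by
  have hRic : IsPseudoMetric U (ηDeformation g ξ (ricciCoeff n c) (ricciCoeffη n c)) :=
    { isOpen := S.isOpen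
      smooth := S.contDiffOn_ηDeformation _ _
      symm := fun z hz v w => by
        rw [ηDeformation_apply, ηDeformation_apply, S.symm z hz v w, mul_comm (g z (ξ z) v)]
      isInvertible := fun z hz => isInvertible_of_nondegenerate fun v hv => by
        obtain ⟨w, hw⟩ := hric z hz v hv
        exact ⟨w, by rwa [← S.ricci_eq hG hz]⟩ }
  exact christoffel_eq
    (S.isLeviCivita_ηDeformation (S.ricciCoeff_ne_zero hG hn hy (hric y hy)) _) hRic
    (fun z hz => S.ricci_eq hG hz) hy v w

end SpaceFormChart

end SpaceForm

/-! ### Immersions and hypersurfaces tangent to `ξ` -/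

section Immersion

variable {E X : Type*} [NormedAddCommGroup E] [NormedSpace ℝ E]
  [NormedAddCommGroup X] [NormedSpace ℝ X]

/-- The metric `f^* g` induced by the map `f`. -/
def inducedForm (g : E → E →L[ℝ] E →L[ℝ] ℝ) (f : X → E) (t : X) : X →L[ℝ] X →L[ℝ] ℝ :=
  (g (f t)).bilinearComp (fderiv ℝ f t) (fderiv ℝ f t)

/-- The orthogonal projection onto the tangent space of the immersion `f`, read on its source. -/
def tangentPart (g : E → E →L[ℝ] E →L[ℝ] ℝ) (f : X → E) (t : X) : E →L[ℝ] X :=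
  (inducedForm g f t).inverse.comp
    (((ContinuousLinearMap.compL ℝ X E ℝ).flip (fderiv ℝ f t)).comp (g (f t)))

/-- `f` is a smooth immersion of the open set `O` into `U`. -/
structure ImmersionChart (U : Set E) (O : Set X) (f : X → E) : Prop where
  isOpen : IsOpen O
  maps : ∀ t ∈ O, f t ∈ U
  smooth : ContDiffOn ℝ ∞ f O
  injective : ∀ t ∈ O, Function.Injective (fderiv ℝ f t)

variable {U : Set E} {g : E → E →L[ℝ] E →L[ℝ] ℝ} {Γ : E → E →L[ℝ] E →L[ℝ] E} {O : Set X}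
  {f : X → E} {D : X → X →L[ℝ] X →L[ℝ] X} {t : X}

lemma inducedForm_apply (v x : X) :
    inducedForm g f t v x = g (f t) (fderiv ℝ f t v) (fderiv ℝ f t x) := rfl

lemma inducedForm_tangentPart (h : (inducedForm g f t).IsInvertible) (z : E) (x : X) :
    inducedForm g f t (tangentPart g f t z) x = g (f t) z (fderiv ℝ f t x) := by
  rw [tangentPart, ContinuousLinearMap.comp_apply, h.self_apply_inverse]
  rfl

namespace ImmersionChart

variable (M : ImmersionChart U O f)
include M

lemma contDiffAt (ht : t ∈ O) : ContDiffAt ℝ ∞ f t :=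
  M.smooth.contDiffAt (M.isOpen.mem_nhds ht)

lemma differentiableAt (ht : t ∈ O) : DifferentiableAt ℝ f t :=
  (M.contDiffAt ht).differentiableAt (by simp)

lemma differentiableAt_fderiv_apply (ht : t ∈ O) (v : X) :
    DifferentiableAt ℝ (fun s => fderiv ℝ f s v) t :=
  (differentiableAt_fderiv (M.contDiffAt ht)).clm_apply (differentiableAt_const v)

variable (hg : IsPseudoMetric U g)
include hg

lemma isPseudoMetric_inducedForm [FiniteDimensional ℝ X]
    (hpos : ∀ y ∈ U, ∀ v, v ≠ 0 → 0 < g y v v) : IsPseudoMetric O (inducedForm g f) where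
  isOpen := M.isOpen
  smooth := by
    have hgf : ContDiffOn ℝ ∞ (fun t => g (f t)) O := hg.smooth.comp M.smooth M.maps
    have hf' := M.smooth.fderiv_of_isOpen M.isOpen (m := ∞) (by simp)
    refine contDiffOn_clm_apply.2 fun v => contDiffOn_clm_apply.2 fun x => ?_
    exact (hgf.clm_apply (hf'.clm_apply contDiffOn_const)).clm_apply
      (hf'.clm_apply contDiffOn_const)
  symm t ht v x := hg.symm _ (M.maps t ht) _ _
  isInvertible t ht := isInvertible_of_pos fun v hv =>
    hpos _ (M.maps t ht) _ fun h => hv (M.injective t ht (h.trans (map_zero _).symm))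

lemma contDiffAt_tangentPart [CompleteSpace X] (hI : IsPseudoMetric O (inducedForm g f))
    (ht : t ∈ O) : ContDiffAt ℝ ∞ (tangentPart g f) t := by
  have hcomp : ContDiffAt ℝ ∞
      (fun s => (ContinuousLinearMap.compL ℝ X E ℝ).flip (fderiv ℝ f s)) t :=
    ((ContinuousLinearMap.compL ℝ X E ℝ).flip.contDiff).contDiffAt.comp t
      (contDiffAt_fderiv (M.contDiffAt ht))
  exact ((hI.isInvertible t ht).contDiffAt_map_inverse.comp t (hI.contDiffAt ht)).clm_comp
    (hcomp.clm_comp ((hg.contDiffAt (M.maps t ht)).comp t (M.contDiffAt ht)))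

lemma inner_fderiv_leviCivita (hΓ : IsLeviCivita U g Γ) (hD : IsLeviCivita O (inducedForm g f) D)
    (hI : IsPseudoMetric O (inducedForm g f)) (ht : t ∈ O) (v x z : X) :
    g (f t) (fderiv ℝ f t (D t v x)) (fderiv ℝ f t z)
      = g (f t) (covDeriv Γ f (fun s => fderiv ℝ f s x) t v) (fderiv ℝ f t z) := by
  have hU := M.maps t ht
  have hfderiv : ∀ a b c, fderiv ℝ (inducedForm g f) t a b c
      = g (f t) (covDeriv Γ f (fun s => fderiv ℝ f s b) t a) (fderiv ℝ f t c)
        + g (f t) (fderiv ℝ f t b) (covDeriv Γ f (fun s => fderiv ℝ f s c) t a) := fun a b c => by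
    rw [← hI.fderiv_apply_apply ht]
    exact hΓ.fderiv_inner hg hU (M.differentiableAt ht) (M.differentiableAt_fderiv_apply ht b)
      (M.differentiableAt_fderiv_apply ht c) a
  have hsymm := covDeriv_fderiv_symm (hΓ.torsion_free _ hU) (M.contDiffAt ht)
  rw [← inducedForm_apply, hD.apply_eq_koszul hI.symm ht, koszul_apply, hfderiv, hfderiv, hfderiv,
    hsymm x v, hsymm z v, hsymm z x, hg.symm _ hU (fderiv ℝ f t x),
    hg.symm _ hU (fderiv ℝ f t v)]
  ring

end ImmersionChart

end Immersion

section ContactHypersurface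

variable {E X : Type*} [NormedAddCommGroup E] [NormedSpace ℝ E]
  [NormedAddCommGroup X] [NormedSpace ℝ X]

/-- `f : O → U` is a hypersurface with smooth unit normal field `ν`, to which the vector field `ξ`
is tangent. -/
structure ContactHypersurface (U : Set E) (g : E → E →L[ℝ] E →L[ℝ] ℝ) (ξ : E → E) (O : Set X)
    (f ν : X → E) : Prop extends ImmersionChart U O f where
  smooth_ν : ContDiffOn ℝ ∞ ν O
  unit : ∀ t ∈ O, g (f t) (ν t) (ν t) = 1
  normal : ∀ t ∈ O, ∀ v, g (f t) (ν t) (fderiv ℝ f t v) = 0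
  spans : ∀ t ∈ O, ∀ x, (∀ v, g (f t) x (fderiv ℝ f t v) = 0) → g (f t) x (ν t) = 0 → x = 0
  tangent_ξ : ∀ t ∈ O, ∃ v, fderiv ℝ f t v = ξ (f t)

/-- The Weingarten operator `A v = -(∇_v ν)^⊤` of the hypersurface `f` with unit normal `ν`. -/
def weingarten (g : E → E →L[ℝ] E →L[ℝ] ℝ) (Γ : E → E →L[ℝ] E →L[ℝ] E) (f ν : X → E) (t : X) :
    X →L[ℝ] X :=
  -(tangentPart g f t).comp (covDeriv Γ f ν t)

/-- The mean curvature `(trace A) / dim X` with respect to the unit normal `ν`. -/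
def meanCurvature (g : E → E →L[ℝ] E →L[ℝ] ℝ) (Γ : E → E →L[ℝ] E →L[ℝ] E) (f ν : X → E) (t : X) :
    ℝ :=
  1 / (Module.finrank ℝ X : ℝ) * LinearMap.trace ℝ X (weingarten g Γ f ν t)

/-- The vector field `v ↦ (ξ ∘ f)^⊤`, which `f` maps to `ξ` if `ξ` is tangent to `f`. -/
def tangentξ (g : E → E →L[ℝ] E →L[ℝ] ℝ) (ξ : E → E) (f : X → E) (t : X) : X :=
  tangentPart g f t (ξ (f t))

namespace ContactHypersurface

variable {U : Set E} {g : E → E →L[ℝ] E →L[ℝ] ℝ} {Γ : E → E →L[ℝ] E →L[ℝ] E} {φ : E → E →L[ℝ] E}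
  {ξ : E → E} {O : Set X} {f ν : X → E} {u : X} (M : ContactHypersurface U g ξ O f ν)
include M

lemma contDiffAt_ν (hu : u ∈ O) : ContDiffAt ℝ ∞ ν u :=
  M.smooth_ν.contDiffAt (M.isOpen.mem_nhds hu)

lemma differentiableAt_ν (hu : u ∈ O) : DifferentiableAt ℝ ν u :=
  (M.contDiffAt_ν hu).differentiableAt (by simp)

lemma normal_ξ (hu : u ∈ O) : g (f u) (ν u) (ξ (f u)) = 0 := by
  obtain ⟨v, hv⟩ := M.tangent_ξ u hu
  rw [← hv, M.normal u hu]

lemma eq_smul_normal (hu : u ∈ O) {x : E} (hx : ∀ v, g (f u) x (fderiv ℝ f u v) = 0) :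
    x = g (f u) x (ν u) • ν u := by
  rw [← sub_eq_zero]
  refine M.spans u hu _ (fun v => ?_) ?_
  · rw [map_sub, map_smul, _root_.sub_apply, _root_.smul_apply, hx, M.normal u hu, smul_zero,
      sub_zero]
  · rw [map_sub, map_smul, _root_.sub_apply, _root_.smul_apply, M.unit u hu, smul_eq_mul, mul_one,
      sub_self]

variable (S : SasakianChart U g Γ φ ξ)
include S

lemma contDiffAt_Γ (hu : u ∈ O) : ContDiffAt ℝ ∞ Γ (f u) :=
  S.isLeviCivita.contDiffAt S.isOpen (M.maps u hu)

lemma contDiffAt_covDeriv_ν (hu : u ∈ O) : ContDiffAt ℝ ∞ (covDeriv Γ f ν) u :=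
  contDiffAt_covDeriv (M.contDiffAt_Γ S hu) (M.contDiffAt hu) (M.contDiffAt_ν hu)

variable [FiniteDimensional ℝ E]

lemma inner_covDeriv_ν (hu : u ∈ O) (v x : X) :
    g (f u) (covDeriv Γ f ν u v) (fderiv ℝ f u x)
      = -g (f u) (ν u) (covDeriv Γ f (fun t => fderiv ℝ f t x) u v) := by
  have hzero : (fun t => g (f t) (ν t) (fderiv ℝ f t x)) =ᶠ[nhds u] fun _ => 0 := by
    filter_upwards [M.isOpen.mem_nhds hu] with t ht using M.normal t ht x
  have h := S.fderiv_inner (M.maps u hu) (M.differentiableAt hu) (M.differentiableAt_ν hu)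
    (M.differentiableAt_fderiv_apply hu x) v
  rw [hzero.fderiv_eq, fderiv_fun_const, Pi.zero_apply, _root_.zero_apply] at h
  linarith

lemma inner_covDeriv_ν_symm (hu : u ∈ O) (v x : X) :
    g (f u) (covDeriv Γ f ν u v) (fderiv ℝ f u x)
      = g (f u) (covDeriv Γ f ν u x) (fderiv ℝ f u v) := by
  rw [M.inner_covDeriv_ν S hu, M.inner_covDeriv_ν S hu,
    covDeriv_fderiv_symm (S.isLeviCivita.torsion_free _ (M.maps u hu)) (M.contDiffAt hu)]

lemma inner_covDeriv_ν_ξ (hu : u ∈ O) (v : X) :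
    g (f u) (covDeriv Γ f ν u v) (ξ (f u)) = g (f u) (ν u) (φ (f u) (fderiv ℝ f u v)) := by
  have hzero : (fun t => g (f t) (ν t) (ξ (f t))) =ᶠ[nhds u] fun _ => 0 := by
    filter_upwards [M.isOpen.mem_nhds hu] with t ht using M.normal_ξ ht
  have h := S.fderiv_inner (M.maps u hu) (M.differentiableAt hu) (M.differentiableAt_ν hu)
    (S.differentiableAt_ξ_along (M.maps u hu) (M.differentiableAt hu)) v
  rw [hzero.fderiv_eq, S.covDeriv_ξ (M.maps u hu) (M.differentiableAt hu), map_neg,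
    fderiv_fun_const, Pi.zero_apply, _root_.zero_apply] at h
  linarith

lemma inner_covDeriv_ν_ν (hu : u ∈ O) (v : X) : g (f u) (covDeriv Γ f ν u v) (ν u) = 0 := by
  have hconst : (fun t => g (f t) (ν t) (ν t)) =ᶠ[nhds u] fun _ => 1 := by
    filter_upwards [M.isOpen.mem_nhds hu] with t ht using M.unit t ht
  have h := S.fderiv_inner (M.maps u hu) (M.differentiableAt hu) (M.differentiableAt_ν hu)
    (M.differentiableAt_ν hu) v
  rw [hconst.fderiv_eq, S.symm _ (M.maps u hu) (ν u), fderiv_fun_const, Pi.zero_apply,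
    _root_.zero_apply] at h
  linarith

variable [FiniteDimensional ℝ X]

lemma isPseudoMetric_inducedForm : IsPseudoMetric O (inducedForm g f) :=
  M.toImmersionChart.isPseudoMetric_inducedForm S.isPseudoMetric S.pos

lemma inducedForm_tangentPart (hu : u ∈ O) (z : E) (x : X) :
    inducedForm g f u (tangentPart g f u z) x = g (f u) z (fderiv ℝ f u x) :=
  _root_.inducedForm_tangentPart ((M.isPseudoMetric_inducedForm S).isInvertible u hu) z x

lemma fderiv_tangentPart (hu : u ∈ O) {z : E} (hz : g (f u) z (ν u) = 0) :
    fderiv ℝ f u (tangentPart g f u z) = z := by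
  rw [← sub_eq_zero]
  refine M.spans u hu _ (fun v => ?_) ?_
  · rw [map_sub, _root_.sub_apply, ← inducedForm_apply, M.inducedForm_tangentPart S hu, sub_self]
  · rw [map_sub, _root_.sub_apply, hz, S.symm _ (M.maps u hu), M.normal u hu, sub_zero]

lemma fderiv_tangentξ (hu : u ∈ O) : fderiv ℝ f u (tangentξ g ξ f u) = ξ (f u) :=
  M.fderiv_tangentPart S hu (by rw [S.symm _ (M.maps u hu), M.normal_ξ hu])

lemma nontrivial (hu : u ∈ O) : Nontrivial X := by
  by_contra h
  have := not_nontrivial_iff_subsingleton.1 h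
  have hξ := M.fderiv_tangentξ S hu
  rw [Subsingleton.elim (tangentξ g ξ f u) 0, map_zero] at hξ
  have hunit := S.unit_ξ _ (M.maps u hu)
  rw [← hξ, map_zero] at hunit
  exact zero_ne_one hunit

lemma contDiffAt_tangentPart (hu : u ∈ O) : ContDiffAt ℝ ∞ (tangentPart g f) u :=
  M.toImmersionChart.contDiffAt_tangentPart S.isPseudoMetric (M.isPseudoMetric_inducedForm S) hu

lemma differentiableAt_tangentξ (hu : u ∈ O) : DifferentiableAt ℝ (tangentξ g ξ f) u :=
  ((M.contDiffAt_tangentPart S hu).differentiableAt (by simp)).clm_apply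
    (S.differentiableAt_ξ_along (M.maps u hu) (M.differentiableAt hu))

lemma fderiv_weingarten (hu : u ∈ O) (v : X) :
    fderiv ℝ f u (weingarten g Γ f ν u v) = -covDeriv Γ f ν u v := by
  rw [weingarten, _root_.neg_apply, map_neg, ContinuousLinearMap.comp_apply,
    M.fderiv_tangentPart S hu (M.inner_covDeriv_ν_ν S hu v)]

lemma inducedForm_weingarten (hu : u ∈ O) (v x : X) :
    inducedForm g f u (weingarten g Γ f ν u v) x
      = -g (f u) (covDeriv Γ f ν u v) (fderiv ℝ f u x) := by
  rw [inducedForm_apply, M.fderiv_weingarten S hu, map_neg, _root_.neg_apply]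

lemma inducedForm_weingarten_symm (hu : u ∈ O) (v x : X) :
    inducedForm g f u (weingarten g Γ f ν u v) x
      = inducedForm g f u v (weingarten g Γ f ν u x) := by
  rw [(M.isPseudoMetric_inducedForm S).symm u hu v, M.inducedForm_weingarten S hu,
    M.inducedForm_weingarten S hu, M.inner_covDeriv_ν_symm S hu]

lemma contDiffAt_weingarten (hu : u ∈ O) : ContDiffAt ℝ ∞ (weingarten g Γ f ν) u :=
  ((M.contDiffAt_tangentPart S hu).clm_comp (M.contDiffAt_covDeriv_ν S hu)).neg

lemma contDiffAt_meanCurvature (hu : u ∈ O) : ContDiffAt ℝ ∞ (meanCurvature g Γ f ν) u :=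
  contDiffAt_const.mul
    ((LinearMap.toContinuousLinearMap (LinearMap.trace ℝ X ∘ₗ
      ContinuousLinearMap.coeLM ℝ)).contDiff.contDiffAt.comp u (M.contDiffAt_weingarten S hu))

lemma covDeriv_ν_tangentξ (hu : u ∈ O) :
    covDeriv Γ f ν u (tangentξ g ξ f u) = -φ (f u) (ν u) := by
  have hU := M.maps u hu
  rw [← sub_eq_zero, sub_neg_eq_add]
  refine M.spans u hu _ (fun v => ?_) ?_
  · rw [map_add, _root_.add_apply, M.inner_covDeriv_ν_symm S hu, M.fderiv_tangentξ S hu,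
      M.inner_covDeriv_ν_ξ S hu, S.skew hU, add_neg_cancel]
  · rw [map_add, _root_.add_apply, M.inner_covDeriv_ν_ν S hu, S.g_φ_self hU, add_zero]

lemma covDeriv_fderiv_tangentξ (hu : u ∈ O) (v : X) :
    covDeriv Γ f (fun t => fderiv ℝ f t v) u (tangentξ g ξ f u)
      = -φ (f u) (fderiv ℝ f u v) - fderiv ℝ f u (fderiv ℝ (tangentξ g ξ f) u v) := by
  have hU := M.maps u hu
  have hξ : (fun t => fderiv ℝ f t (tangentξ g ξ f t)) =ᶠ[nhds u] fun t => ξ (f t) := by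
    filter_upwards [M.isOpen.mem_nhds hu] with t ht using M.fderiv_tangentξ S ht
  have h := DFunLike.congr_fun (covDeriv_congr Γ f hξ) v
  rw [S.covDeriv_ξ hU (M.differentiableAt hu), covDeriv_apply,
    fderiv_clm_apply_apply (differentiableAt_fderiv (M.contDiffAt hu))
      (M.differentiableAt_tangentξ S hu)] at h
  rw [covDeriv_fderiv_symm (S.isLeviCivita.torsion_free _ hU) (M.contDiffAt hu), ← h,
    covDeriv_apply, fderiv_fderiv_apply (M.contDiffAt hu)]
  abel

lemma fderiv_inducedForm_tangentξ (hu : u ∈ O) (v x : X) :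
    fderiv ℝ (inducedForm g f) u (tangentξ g ξ f u) v x
      = -inducedForm g f u (fderiv ℝ (tangentξ g ξ f) u v) x
        - inducedForm g f u v (fderiv ℝ (tangentξ g ξ f) u x) := by
  have hU := M.maps u hu
  have h := S.fderiv_inner hU (M.differentiableAt hu) (M.differentiableAt_fderiv_apply hu v)
    (M.differentiableAt_fderiv_apply hu x) (tangentξ g ξ f u)
  rw [M.covDeriv_fderiv_tangentξ S hu, M.covDeriv_fderiv_tangentξ S hu] at h
  rw [← (M.isPseudoMetric_inducedForm S).fderiv_apply_apply hu]
  refine h.trans ?_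
  simp only [inducedForm_apply, map_sub, map_neg, _root_.sub_apply, _root_.neg_apply, S.skew hU]
  ring

end ContactHypersurface

end ContactHypersurface

/-! ### The mean curvature along `ξ` -/

section MeanCurvature

variable {E X : Type*} [NormedAddCommGroup E] [NormedSpace ℝ E] [FiniteDimensional ℝ E]
  [NormedAddCommGroup X] [NormedSpace ℝ X] [FiniteDimensional ℝ X]
  {U : Set E} {g : E → E →L[ℝ] E →L[ℝ] ℝ} {Γ : E → E →L[ℝ] E →L[ℝ] E} {φ : E → E →L[ℝ] E}
  {ξ : E → E} {c : ℝ} {O : Set X} {f ν : X → E} {u : X}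

namespace ContactHypersurface

variable (M : ContactHypersurface U g ξ O f ν) (S : SpaceFormChart U g Γ φ ξ c)
include M S

lemma covDeriv_covDeriv_ν_tangentξ (hu : u ∈ O) (v : X) :
    covDeriv Γ f (fun t => covDeriv Γ f ν t v) u (tangentξ g ξ f u)
      = -φ (f u) (covDeriv Γ f ν u v) - covDeriv Γ f ν u (fderiv ℝ (tangentξ g ξ f) u v) := by
  have hU := M.maps u hu
  have df := M.differentiableAt hu
  have dν := M.differentiableAt_ν hu
  have hΓ := M.contDiffAt_Γ S.toSasakianChart hu
  have dφν : DifferentiableAt ℝ (fun t => φ (f t) (ν t)) u :=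
    DifferentiableAt.clm_apply (c := fun t => φ (f t))
      (((S.contDiffAt_φ hU).differentiableAt (by simp)).comp u df) dν
  have hνξ : g (f u) (ξ (f u)) (ν u) = 0 := by rw [S.symm _ hU, M.normal_ξ hu]
  have hνdf : g (f u) (fderiv ℝ f u v) (ν u) = 0 := by rw [S.symm _ hU, M.normal u hu]
  have hν : (fun t => covDeriv Γ f ν t (tangentξ g ξ f t))
      =ᶠ[nhds u] fun t => (-1 : ℝ) • φ (f t) (ν t) := by
    filter_upwards [M.isOpen.mem_nhds hu] with t ht
    rw [M.covDeriv_ν_tangentξ S.toSasakianChart ht, neg_one_smul]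
  have hcov := DFunLike.congr_fun (covDeriv_congr Γ f hν) v
  rw [covDeriv_smul (differentiableAt_const _) dφν, S.covDeriv_φ hU df dν,
    covDeriv_covDeriv_apply hΓ (M.contDiffAt hu) (M.contDiffAt_ν hu)
      (M.differentiableAt_tangentξ S.toSasakianChart hu), hνdf, hνξ, fderiv_fun_const,
    Pi.zero_apply, _root_.zero_apply, zero_smul, zero_add, zero_smul, zero_smul, add_zero, sub_zero,
    neg_one_smul] at hcov
  rw [covDeriv_comm hΓ (M.contDiffAt hu) (M.contDiffAt_ν hu),
    M.fderiv_tangentξ S.toSasakianChart hu, S.curv_ξ hU, hνdf, hνξ, eq_sub_of_add_eq hcov,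
    zero_smul, zero_smul, sub_zero, add_zero]

/-- The flow of `ξ` preserves the second fundamental form. -/
lemma fderiv_inner_covDeriv_ν_tangentξ (hu : u ∈ O) (v x : X) :
    fderiv ℝ (fun t => g (f t) (covDeriv Γ f ν t v) (fderiv ℝ f t x)) u (tangentξ g ξ f u)
      = -g (f u) (covDeriv Γ f ν u (fderiv ℝ (tangentξ g ξ f) u v)) (fderiv ℝ f u x)
        - g (f u) (covDeriv Γ f ν u v) (fderiv ℝ f u (fderiv ℝ (tangentξ g ξ f) u x)) := by
  have hU := M.maps u hu
  rw [S.fderiv_inner hU (M.differentiableAt hu)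
    (((M.contDiffAt_covDeriv_ν S.toSasakianChart hu).differentiableAt (by simp)).clm_apply
      (differentiableAt_const v)) (M.differentiableAt_fderiv_apply hu x),
    M.covDeriv_covDeriv_ν_tangentξ S hu, M.covDeriv_fderiv_tangentξ S.toSasakianChart hu]
  simp only [map_sub, map_neg, _root_.sub_apply, _root_.neg_apply, S.skew hU]
  ring

lemma fderiv_weingarten_tangentξ (hu : u ∈ O) :
    fderiv ℝ (weingarten g Γ f ν) u (tangentξ g ξ f u)
      = (fderiv ℝ (tangentξ g ξ f) u).comp (weingarten g Γ f ν u)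
        - (weingarten g Γ f ν u).comp (fderiv ℝ (tangentξ g ξ f) u) := by
  have hI := M.isPseudoMetric_inducedForm S.toSasakianChart
  have dA := (M.contDiffAt_weingarten S.toSasakianChart hu).differentiableAt (by simp)
  refine ContinuousLinearMap.ext fun v => eq_of_forall_apply_eq (hI.isInvertible u hu) fun x => ?_
  have hA : (fun t => inducedForm g f t (weingarten g Γ f ν t v) x)
      =ᶠ[nhds u] fun t => -g (f t) (covDeriv Γ f ν t v) (fderiv ℝ f t x) := by
    filter_upwards [M.isOpen.mem_nhds hu] with t ht
      using M.inducedForm_weingarten S.toSasakianChart ht v x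
  have hderiv := fderiv_bilin_along (f := fun t => t) (hI.differentiableAt hu) differentiableAt_id
    (dA.clm_apply (differentiableAt_const v)) (differentiableAt_const x) (tangentξ g ξ f u)
  rw [hA.fderiv_eq, fderiv_fun_neg, _root_.neg_apply, M.fderiv_inner_covDeriv_ν_tangentξ S hu,
    fderiv_fun_id, ContinuousLinearMap.id_apply,
    M.fderiv_inducedForm_tangentξ S.toSasakianChart hu,
    fderiv_clm_apply_apply dA (differentiableAt_const v)] at hderiv
  simp only [fderiv_fun_const, Pi.zero_apply, _root_.zero_apply, map_zero, add_zero] at hderiv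
  rw [_root_.sub_apply, map_sub, _root_.sub_apply, ContinuousLinearMap.comp_apply,
    ContinuousLinearMap.comp_apply, M.inducedForm_weingarten S.toSasakianChart hu (fderiv ℝ _ u v)]
  rw [M.inducedForm_weingarten S.toSasakianChart hu v (fderiv ℝ _ u x)] at hderiv
  linarith

theorem fderiv_meanCurvature_tangentξ (hu : u ∈ O) :
    fderiv ℝ (meanCurvature g Γ f ν) u (tangentξ g ξ f u) = 0 := by
  let tr : (X →L[ℝ] X) →L[ℝ] ℝ :=
    LinearMap.toContinuousLinearMap (LinearMap.trace ℝ X ∘ₗ ContinuousLinearMap.coeLM ℝ)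
  have dA := (M.contDiffAt_weingarten S.toSasakianChart hu).differentiableAt (by simp)
  have hmul : ∀ L K : X →L[ℝ] X, tr (L.comp K) = tr (K.comp L) := fun L K =>
    LinearMap.trace_mul_comm ℝ (L : X →ₗ[ℝ] X) (K : X →ₗ[ℝ] X)
  have htr : fderiv ℝ (fun t => tr (weingarten g Γ f ν t)) u (tangentξ g ξ f u) = 0 := by
    rw [fderiv_fun_comp u tr.differentiableAt dA, tr.fderiv, ContinuousLinearMap.comp_apply,
      M.fderiv_weingarten_tangentξ S hu, map_sub, hmul, sub_self]
  have dtr : DifferentiableAt ℝ (fun t => tr (weingarten g Γ f ν t)) u :=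
    tr.differentiableAt.comp u dA
  have hmean := fderiv_const_mul dtr (1 / (Module.finrank ℝ X : ℝ))
  exact (DFunLike.congr_fun hmean _).trans (by rw [_root_.smul_apply, htr, smul_zero])

end ContactHypersurface

end MeanCurvature

/-! ### The bitension field -/

section Bitension

variable {E X : Type*} [NormedAddCommGroup E] [NormedSpace ℝ E] [FiniteDimensional ℝ E]
  [NormedAddCommGroup X] [NormedSpace ℝ X]
  {U : Set E} {g : E → E →L[ℝ] E →L[ℝ] ℝ} {Γ : E → E →L[ℝ] E →L[ℝ] E} {φ : E → E →L[ℝ] E}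
  {ξ : E → E} {κ : ℝ} {O : Set X} {f ν : X → E} {D : X → X →L[ℝ] X →L[ℝ] X} {h : X → ℝ} {u : X}

/-- The tangential part `J` of `φ` along the immersion `f`. -/
def tangentφ (g : E → E →L[ℝ] E →L[ℝ] ℝ) (φ : E → E →L[ℝ] E) (f : X → E) (t : X) : X →L[ℝ] X :=
  (tangentPart g f t).comp ((φ (f t)).comp (fderiv ℝ f t))

/-- The vector field `V = -φ ν` of a hypersurface with unit normal `ν`, read on its source. -/
def tangentV (g : E → E →L[ℝ] E →L[ℝ] ℝ) (φ : E → E →L[ℝ] E) (f ν : X → E) (t : X) : X :=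
  tangentPart g f t (-φ (f t) (ν t))

/-- The endomorphism of the tangent space of the hypersurface `f` which represents, with respect to
the induced metric, the `ξ`-component of the second covariant derivative `(∇*)² (h ν)`. -/
def hessianEndo (g : E → E →L[ℝ] E →L[ℝ] ℝ) (Γ : E → E →L[ℝ] E →L[ℝ] E) (φ : E → E →L[ℝ] E)
    (f ν : X → E) (h : X → ℝ) (t : X) : X →L[ℝ] X :=
  (fderiv ℝ h t).smulRight (tangentV g φ f ν t)
    + (inducedForm g f t (tangentV g φ f ν t)).smulRight
      ((inducedForm g f t).inverse (fderiv ℝ h t))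
    + h t • ((tangentφ g φ f t).comp (weingarten g Γ f ν t)
      - (weingarten g Γ f ν t).comp (tangentφ g φ f t))

namespace ContactHypersurface

variable (M : ContactHypersurface U g ξ O f ν) (S : SasakianChart U g Γ φ ξ)
include M S

/-- For a field normal to the hypersurface, the second fundamental form contributes a multiple of
`g(ν, φ ν) = 0`. -/
lemma η_secondCovDeriv_normal (hD : IsLeviCivita O (inducedForm g f) D) [FiniteDimensional ℝ X]
    (hu : u ∈ O) (hh : ContDiffAt ℝ ∞ h u) (v x : X) :
    g (f u) (ξ (f u))
        (covDeriv (deformedConnection g Γ φ ξ κ) f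
            (fun t => covDeriv (deformedConnection g Γ φ ξ κ) f (fun t => h t • ν t) t x) u v
          - covDeriv (deformedConnection g Γ φ ξ κ) f (fun t => h t • ν t) u (D u v x))
      = g (f u) (covDeriv Γ f (fun t => h t • ν t) u v) (φ (f u) (fderiv ℝ f u x))
        + g (f u) (covDeriv Γ f (fun t => h t • ν t) u x) (φ (f u) (fderiv ℝ f u v)) := by
  have hU := M.maps u hu
  have hZ : ContDiffAt ℝ ∞ (fun t => h t • ν t) u := hh.smul (M.contDiffAt_ν hu)
  have hν : ∀ t ∈ O, g (f t) (ξ (f t)) (h t • ν t) = 0 := fun t ht => by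
    rw [map_smul, S.symm _ (M.maps t ht), M.normal_ξ ht, smul_zero]
  have hη : (fun t => g (f t) (ξ (f t)) (h t • ν t)) =ᶠ[nhds u] fun _ => 0 := by
    filter_upwards [M.isOpen.mem_nhds hu] with t ht using hν t ht
  have hη' : fderiv ℝ (fun t => g (f t) (ξ (f t)) (h t • ν t)) =ᶠ[nhds u] fun _ => 0 := by
    filter_upwards [hη.eventuallyEq_nhds] with t ht
    rw [ht.fderiv_eq, fderiv_fun_const, Pi.zero_apply]
  have hnormal : g (f u) (ν u) (φ (f u) (covDeriv Γ f (fun t => fderiv ℝ f t x) u v))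
      = g (f u) (ν u) (φ (f u) (fderiv ℝ f u (D u v x))) := by
    have hsub := M.eq_smul_normal hu
      (x := covDeriv Γ f (fun t => fderiv ℝ f t x) u v - fderiv ℝ f u (D u v x)) fun z => by
      rw [map_sub, _root_.sub_apply, M.inner_fderiv_leviCivita S.isPseudoMetric S.isLeviCivita hD
        (M.isPseudoMetric_inducedForm S) hu, sub_self]
    rw [← sub_eq_zero, ← map_sub, ← map_sub, hsub, map_smul, map_smul, S.symm _ hU (ν u),
      S.g_φ_self hU, smul_zero]
  rw [map_sub, S.η_covDeriv_covDeriv_deformedConnection hU (M.contDiffAt hu) hZ,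
    S.η_covDeriv_deformedConnection hU (M.differentiableAt hu) (hZ.differentiableAt (by simp)),
    hη'.fderiv_eq, hη.fderiv_eq, hν u hu, S.g_φ _ hU]
  simp only [fderiv_fun_const, Pi.zero_apply, _root_.zero_apply, map_smul, _root_.smul_apply,
    smul_eq_mul, M.normal u hu, hnormal, S.symm _ hU (ξ (f u)) (ν u), M.normal_ξ hu]
  ring

variable [FiniteDimensional ℝ X]

lemma fderiv_tangentV (hu : u ∈ O) :
    fderiv ℝ f u (tangentV g φ f ν u) = -φ (f u) (ν u) :=
  M.fderiv_tangentPart S hu (by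
    rw [map_neg, _root_.neg_apply, S.g_φ_self (M.maps u hu), neg_zero])

/-- This is `∇_v (h ν) = dh(v) ν - h A v`, paired with `φ x`. -/
lemma inner_covDeriv_smul_ν (hu : u ∈ O) (hh : DifferentiableAt ℝ h u) (v x : X) :
    g (f u) (covDeriv Γ f (fun t => h t • ν t) u v) (φ (f u) (fderiv ℝ f u x))
      = fderiv ℝ h u v * inducedForm g f u (tangentV g φ f ν u) x
        + h u * inducedForm g f u (tangentφ g φ f u (weingarten g Γ f ν u v)) x := by
  have hU := M.maps u hu
  have hA : covDeriv Γ f ν u v = -fderiv ℝ f u (weingarten g Γ f ν u v) := by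
    rw [M.fderiv_weingarten S hu, neg_neg]
  rw [covDeriv_smul hh (M.differentiableAt_ν hu), hA, tangentV, tangentφ,
    ContinuousLinearMap.comp_apply, ContinuousLinearMap.comp_apply,
    M.inducedForm_tangentPart S hu, M.inducedForm_tangentPart S hu]
  simp only [map_add, map_smul, map_neg, _root_.add_apply, _root_.smul_apply, _root_.neg_apply,
    smul_eq_mul, S.skew hU]
  ring

lemma inducedForm_tangentφ_skew (hu : u ∈ O) (v x : X) :
    inducedForm g f u (tangentφ g φ f u v) x = -inducedForm g f u v (tangentφ g φ f u x) := by
  have hU := M.maps u hu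
  rw [(M.isPseudoMetric_inducedForm S).symm u hu v, tangentφ, ContinuousLinearMap.comp_apply,
    ContinuousLinearMap.comp_apply, ContinuousLinearMap.comp_apply, ContinuousLinearMap.comp_apply,
    M.inducedForm_tangentPart S hu, M.inducedForm_tangentPart S hu, S.skew hU, S.symm _ hU]

lemma inducedForm_hessianEndo (hu : u ∈ O) (hh : DifferentiableAt ℝ h u) (v x : X) :
    inducedForm g f u (hessianEndo g Γ φ f ν h u v) x
      = g (f u) (covDeriv Γ f (fun t => h t • ν t) u v) (φ (f u) (fderiv ℝ f u x))
        + g (f u) (covDeriv Γ f (fun t => h t • ν t) u x) (φ (f u) (fderiv ℝ f u v)) := by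
  have hI := M.isPseudoMetric_inducedForm S
  have hJA : inducedForm g f u (tangentφ g φ f u (weingarten g Γ f ν u x)) v
      = -inducedForm g f u (weingarten g Γ f ν u (tangentφ g φ f u v)) x := by
    rw [M.inducedForm_tangentφ_skew S hu, hI.symm u hu (weingarten g Γ f ν u x),
      M.inducedForm_weingarten_symm S hu]
  rw [M.inner_covDeriv_smul_ν S hu hh, M.inner_covDeriv_smul_ν S hu hh, hJA, hessianEndo]
  simp only [_root_.add_apply, _root_.smul_apply, _root_.sub_apply,
    ContinuousLinearMap.smulRight_apply, ContinuousLinearMap.comp_apply, map_add, map_smul, map_sub,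
    smul_eq_mul, (hI.isInvertible u hu).self_apply_inverse]
  ring

lemma trace_hessianEndo (hu : u ∈ O) :
    LinearMap.trace ℝ X (hessianEndo g Γ φ f ν h u) = 2 * fderiv ℝ h u (tangentV g φ f ν u) := by
  have hI := M.isPseudoMetric_inducedForm S
  have hcomm : LinearMap.trace ℝ X ((tangentφ g φ f u).comp (weingarten g Γ f ν u))
      = LinearMap.trace ℝ X ((weingarten g Γ f ν u).comp (tangentφ g φ f u)) :=
    LinearMap.trace_mul_comm ℝ (tangentφ g φ f u : X →ₗ[ℝ] X) (weingarten g Γ f ν u : X →ₗ[ℝ] X)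
  have hrank (L : X →L[ℝ] ℝ) (x : X) : LinearMap.trace ℝ X (L.smulRight x) = L x :=
    LinearMap.trace_smulRight (L : X →ₗ[ℝ] ℝ) x
  rw [hessianEndo]
  simp only [ContinuousLinearMap.toLinearMap_add, ContinuousLinearMap.toLinearMap_smul,
    ContinuousLinearMap.toLinearMap_sub, map_add, map_smul, map_sub, hrank, hcomm, sub_self,
    smul_zero, add_zero]
  rw [hI.symm u hu (tangentV g φ f ν u), (hI.isInvertible u hu).self_apply_inverse, two_mul]

end ContactHypersurface

end Bitension

section CoordinateBitension

namespace Coord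

variable {n k : ℕ} {G : Eu n → Eu n → Eu n → ℝ} {f Z W : Eu k → Eu n} {u : Eu k}

lemma covAlong_congr (h : Z =ᶠ[nhds u] W) (v : Eu k) : covAlong G f Z u v = covAlong G f W u v := by
  rw [covAlong, covAlong, h.fderiv_eq, h.eq_of_nhds]

lemma bitension_congr (h : Z =ᶠ[nhds u] W) (b : Eu k → Eu k → Eu k → ℝ) :
    bitension G f Z b u = bitension G f W b u := by
  have hsecond : secondCov (induced G f) (ricci G) f Z u
      = secondCov (induced G f) (ricci G) f W u := by
    ext1 v
    ext1 w
    have hcov : (fun t => covAlong (ricci G) f Z t w) =ᶠ[nhds u]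
        fun t => covAlong (ricci G) f W t w := by
      filter_upwards [h.eventuallyEq_nhds] with t ht using covAlong_congr ht w
    rw [secondCov, secondCov, covAlong_congr hcov, covAlong_congr h]
  rw [bitension, bitension, hsecond, h.eq_of_nhds]

lemma secondCov_eq_covDeriv {U : Set (Eu n)} {O : Set (Eu k)} {I : Eu k → Eu k → Eu k → ℝ}
    {Γ : Eu n → Eu n →L[ℝ] Eu n →L[ℝ] Eu n} {D : Eu k → Eu k →L[ℝ] Eu k →L[ℝ] Eu k}
    (hO : IsOpen O) (hf : ∀ t ∈ O, f t ∈ U) (hΓ : ∀ y ∈ U, ∀ v w, christoffel G y v w = Γ y v w)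
    (hD : ∀ t ∈ O, ∀ v w, christoffel I t v w = D t v w) (hu : u ∈ O) (v w : Eu k) :
    secondCov I G f Z u v w
      = covDeriv Γ f (fun t => covDeriv Γ f Z t w) u v - covDeriv Γ f Z u (D u v w) := by
  have hcov : (fun t => covAlong G f Z t w) =ᶠ[nhds u] fun t => covDeriv Γ f Z t w := by
    filter_upwards [hO.mem_nhds hu] with t ht using covAlong_eq_covDeriv hΓ (hf t ht) w
  rw [secondCov, covAlong_eq_covDeriv hΓ (hf u hu), covAlong_eq_covDeriv hΓ (hf u hu),
    covDeriv_congr Γ f hcov, hD u hu]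

end Coord

namespace ContactHypersurface

variable {n k : ℕ} {U : Set (Eu n)} {g : Eu n → Eu n →L[ℝ] Eu n →L[ℝ] ℝ}
  {Γ : Eu n → Eu n →L[ℝ] Eu n →L[ℝ] Eu n} {φ : Eu n → Eu n →L[ℝ] Eu n} {ξ : Eu n → Eu n} {c : ℝ}
  {O : Set (Eu k)} {f ν : Eu k → Eu n} {G : Eu n → Eu n → Eu n → ℝ} {h : Eu k → ℝ} {u : Eu k}
  (M : ContactHypersurface U g ξ O f ν) (S : SpaceFormChart U g Γ φ ξ c)
  (hG : ∀ y ∈ U, ∀ v w, G y v w = g y v w) (hn : 2 ≤ n)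
  (hric : ∀ y ∈ U, ∀ v, v ≠ 0 → ∃ w, ricci G y v w ≠ 0)
include M S hG hn hric

lemma η_riemann_ricci_normal (hu : u ∈ O) (r : ℝ) (v w : Eu k) :
    g (f u) (ξ (f u))
      (riemann (ricci G) (f u) (fderiv ℝ f u v) (r • ν u) (fderiv ℝ f u w)) = 0 := by
  have hU := M.maps u hu
  rw [riemann_eq_curv S.isOpen (S.contDiffOn_deformedConnection _)
    (fun _ hy => S.christoffel_ricci_eq hG hn hric hy) hU, S.η_curv_deformedConnection hU,
    map_smul, map_smul, S.symm _ hU (ξ (f u)) (ν u), M.normal_ξ hu, _root_.smul_apply,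
    M.normal u hu, smul_zero, zero_mul, mul_zero, sub_zero, mul_zero]

lemma η_secondCov_ricci (hu : u ∈ O) (hh : ContDiffAt ℝ ∞ h u) (v w : Eu k) :
    g (f u) (ξ (f u)) (secondCov (induced G f) (ricci G) f (fun t => h t • ν t) u v w)
      = inducedForm g f u (hessianEndo g Γ φ f ν h u v) w := by
  have hI := M.isPseudoMetric_inducedForm S.toSasakianChart
  have hinduced : ∀ t ∈ O, ∀ v w, induced G f t v w = inducedForm g f t v w := fun t ht v w =>
    hG _ (M.maps t ht) _ _
  rw [secondCov_eq_covDeriv M.isOpen M.maps (fun _ hy => S.christoffel_ricci_eq hG hn hric hy)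
      (fun _ ht => christoffel_eq hI.isLeviCivita hI hinduced ht) hu,
    M.η_secondCovDeriv_normal S.toSasakianChart hI.isLeviCivita hu hh,
    M.inducedForm_hessianEndo S.toSasakianChart hu (hh.differentiableAt (by simp))]

theorem η_bitension (hu : u ∈ O) (hh : ContDiffAt ℝ ∞ h u) (b : Eu k → Eu k → Eu k → ℝ) :
    g (f u) (ξ (f u)) (bitension G f (fun t => h t • ν t) b u)
      = 2 * fderiv ℝ h u (tangentV g φ f ν u) := by
  have hI := M.isPseudoMetric_inducedForm S.toSasakianChart
  have hinduced : induced G f u = fun v w => inducedForm g f u v w := by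
    ext1 v
    ext1 w
    exact hG _ (M.maps u hu) _ _
  rw [bitension, map_sub, hinduced, apply_traceWrt_eq_trace (hI.symm u hu) (hI.isInvertible u hu)
    (M.η_secondCov_ricci S hG hn hric hu hh), M.trace_hessianEndo S.toSasakianChart hu]
  simp only [traceWrt, map_sum, map_smul, M.η_riemann_ricci_normal S hG hn hric hu, smul_zero,
    Finset.sum_const_zero, sub_zero]

end ContactHypersurface

end CoordinateBitension

/-! ### Unit normals -/

section UnitNormals

variable {E X : Type*} [NormedAddCommGroup E] [NormedSpace ℝ E]
  [NormedAddCommGroup X] [NormedSpace ℝ X]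

/-- The component of `z` orthogonal to the tangent space of the immersion `f`. -/
def normalPart (g : E → E →L[ℝ] E →L[ℝ] ℝ) (f : X → E) (z : E) (t : X) : E :=
  z - fderiv ℝ f t (tangentPart g f t z)

variable {U : Set E} {g : E → E →L[ℝ] E →L[ℝ] ℝ} {O : Set X} {f : X → E} {u : X}

lemma inner_normalPart (h : (inducedForm g f u).IsInvertible) (z : E) (v : X) :
    g (f u) (normalPart g f z u) (fderiv ℝ f u v) = 0 := by
  rw [normalPart, map_sub, _root_.sub_apply, ← inducedForm_apply, inducedForm_tangentPart h,
    sub_self]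

lemma normalPart_eq_self (h : (inducedForm g f u).IsInvertible) {z : E}
    (hz : ∀ v, g (f u) z (fderiv ℝ f u v) = 0) : normalPart g f z u = z := by
  have htan : tangentPart g f u z = 0 := eq_of_forall_apply_eq h fun v => by
    rw [inducedForm_tangentPart h, hz, map_zero, _root_.zero_apply]
  rw [normalPart, htan, map_zero, sub_zero]

namespace ImmersionChart

variable (M : ImmersionChart U O f)
include M

lemma contDiffOn_normalPart [CompleteSpace X] (hg : IsPseudoMetric U g)
    (hI : IsPseudoMetric O (inducedForm g f)) (z : E) : ContDiffOn ℝ ∞ (normalPart g f z) O :=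
  contDiffOn_const.sub ((M.smooth.fderiv_of_isOpen M.isOpen (by simp)).clm_apply fun _ ht =>
    ((M.contDiffAt_tangentPart hg hI ht).clm_apply contDiffAt_const).contDiffWithinAt)

lemma exists_unit_normal_field [CompleteSpace X] (hg : IsPseudoMetric U g)
    (hI : IsPseudoMetric O (inducedForm g f)) (hu : u ∈ O) {N : E} (hunit : g (f u) N N = 1)
    (hnormal : ∀ v, g (f u) N (fderiv ℝ f u v) = 0) :
    ∃ O' ⊆ O, IsOpen O' ∧ u ∈ O' ∧ ∃ ν : X → E, ContDiffOn ℝ ∞ ν O' ∧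
      (∀ t ∈ O', g (f t) (ν t) (ν t) = 1) ∧ (∀ t ∈ O', ∀ v, g (f t) (ν t) (fderiv ℝ f t v) = 0) ∧
      ν u = N := by
  let q : X → ℝ := fun t => g (f t) (normalPart g f N t) (normalPart g f N t)
  have hν := M.contDiffOn_normalPart hg hI N
  have hνu : normalPart g f N u = N := normalPart_eq_self (hI.isInvertible u hu) hnormal
  have hqu : q u = 1 := by simp only [q, hνu, hunit]
  have hq : ContDiffOn ℝ ∞ q O := ((hg.smooth.comp M.smooth M.maps).clm_apply hν).clm_apply hν
  have hpos : ∀ t ∈ O ∩ q ⁻¹' Set.Ioi 0, 0 < √(q t) := fun t ht => Real.sqrt_pos.2 ht.2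
  refine ⟨O ∩ q ⁻¹' Set.Ioi 0, Set.inter_subset_left,
    hq.continuousOn.isOpen_inter_preimage M.isOpen isOpen_Ioi,
    ⟨hu, by rw [Set.mem_preimage, hqu]; exact Set.mem_Ioi.2 one_pos⟩,
    fun t => (√(q t))⁻¹ • normalPart g f N t, ?_, fun t ht => ?_, fun t ht v => ?_, ?_⟩
  · have hsqrt : ContDiffOn ℝ ∞ (fun t => √(q t)) (O ∩ q ⁻¹' Set.Ioi 0) := fun t ht =>
      ((hq.mono Set.inter_subset_left) t ht).sqrt (ne_of_gt ht.2)
    exact (hsqrt.inv fun t ht => (hpos t ht).ne').smul (hν.mono Set.inter_subset_left)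
  · have hsq : g (f t) (normalPart g f N t) (normalPart g f N t) = √(q t) * √(q t) :=
      (Real.mul_self_sqrt (le_of_lt ht.2)).symm
    have hne := (hpos t ht).ne'
    simp only [map_smul, _root_.smul_apply, smul_eq_mul, hsq]
    field_simp
  · rw [map_smul, _root_.smul_apply, inner_normalPart (hI.isInvertible t ht.1), smul_zero]
  · simp only [hqu, hνu, Real.sqrt_one, inv_one, one_smul]

lemma eq_zero_of_orthogonal [FiniteDimensional ℝ E] [FiniteDimensional ℝ X]
    (hdim : Module.finrank ℝ E = Module.finrank ℝ X + 1) (hpos : ∀ y ∈ U, ∀ v, v ≠ 0 → 0 < g y v v)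
    (hu : u ∈ O) {n x : E} (hunit : g (f u) n n = 1)
    (hnormal : ∀ v, g (f u) n (fderiv ℝ f u v) = 0)
    (hx : ∀ v, g (f u) x (fderiv ℝ f u v) = 0) (hxn : g (f u) x n = 0) : x = 0 := by
  let L : (X × ℝ) →ₗ[ℝ] E :=
    (fderiv ℝ f u).toLinearMap.coprod (LinearMap.toSpanSingleton ℝ E n)
  have hL : ∀ v r, L (v, r) = fderiv ℝ f u v + r • n := fun _ _ => rfl
  have hinj : Function.Injective L := by
    refine LinearMap.ker_eq_bot.1 (LinearMap.ker_eq_bot'.2 ?_)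
    rintro ⟨v, r⟩ h
    rw [hL] at h
    have hr : r = 0 := by simpa [hunit, hnormal] using congrArg (g (f u) n) h
    rw [hr, zero_smul, add_zero] at h
    rw [M.injective u hu (h.trans (map_zero _).symm), hr, Prod.mk_zero_zero]
  obtain ⟨⟨v, r⟩, hvr⟩ := (LinearMap.injective_iff_surjective_of_finrank_eq_finrank
    (by rw [Module.finrank_prod, Module.finrank_self, hdim])).1 hinj x
  by_contra hx0
  refine (hpos _ (M.maps u hu) x hx0).ne' ?_
  nth_rw 2 [← hvr]
  rw [hL, map_add, map_smul, hx, hxn, smul_zero, add_zero]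

lemma exists_contactHypersurface [FiniteDimensional ℝ E] [FiniteDimensional ℝ X]
    (hdim : Module.finrank ℝ E = Module.finrank ℝ X + 1) (hg : IsPseudoMetric U g)
    (hpos : ∀ y ∈ U, ∀ v, v ≠ 0 → 0 < g y v v) {ξ : E → E}
    (hξ : ∀ t ∈ O, ∃ v, fderiv ℝ f t v = ξ (f t)) (hu : u ∈ O) {N : E} (hunit : g (f u) N N = 1)
    (hnormal : ∀ v, g (f u) N (fderiv ℝ f u v) = 0) :
    ∃ O' ⊆ O, u ∈ O' ∧ ∃ ν, ContactHypersurface U g ξ O' f ν ∧ ν u = N := by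
  obtain ⟨O', hO', hopen, hu', ν, hν, hν_unit, hν_normal, hνu⟩ :=
    M.exists_unit_normal_field hg (M.isPseudoMetric_inducedForm hg hpos) hu hunit hnormal
  exact ⟨O', hO', hu', ν,
    { isOpen := hopen
      maps := fun t ht => M.maps t (hO' ht)
      smooth := M.smooth.mono hO'
      injective := fun t ht => M.injective t (hO' ht)
      smooth_ν := hν
      unit := hν_unit
      normal := hν_normal
      spans := fun t ht _ =>
        M.eq_zero_of_orthogonal hdim hpos (hO' ht) (hν_unit t ht) (hν_normal t ht)
      tangent_ξ := fun t ht => hξ t (hO' ht) }, hνu⟩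

end ImmersionChart

namespace ContactHypersurface

variable {Γ : E → E →L[ℝ] E →L[ℝ] E} {φ : E → E →L[ℝ] E} {ξ : E → E} {ν : X → E}
  (M : ContactHypersurface U g ξ O f ν)
include M

lemma exists_eq_smul_normal (hu : u ∈ O) {N : E} (hunit : g (f u) N N = 1)
    (hnormal : ∀ v, g (f u) N (fderiv ℝ f u v) = 0) : ∃ s : ℝ, s * s = 1 ∧ N = s • ν u := by
  have hN := M.eq_smul_normal hu hnormal
  refine ⟨_, ?_, hN⟩
  rw [hN] at hunit
  simpa [M.unit u hu] using hunit

lemma eq_smul_weingarten [FiniteDimensional ℝ E] [FiniteDimensional ℝ X]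
    (S : SasakianChart U g Γ φ ξ) (hu : u ∈ O) {s : ℝ} {B : X →L[ℝ] X}
    (hB : ∀ v x, inducedForm g f u (B v) x
      = g (f u) (covDeriv Γ f (fun t => fderiv ℝ f t x) u v) (s • ν u)) :
    B = s • weingarten g Γ f ν u := by
  ext1 v
  refine eq_of_forall_apply_eq ((M.isPseudoMetric_inducedForm S).isInvertible u hu) fun x => ?_
  rw [hB, _root_.smul_apply, map_smul, map_smul, _root_.smul_apply, M.inducedForm_weingarten S hu,
    M.inner_covDeriv_ν S hu, S.symm _ (M.maps u hu), neg_neg]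

end ContactHypersurface

end UnitNormals

/-! ### Passage to charts -/

section Charts

variable {n : ℕ} {P : Type*} [TopologicalSpace P] [ChartedSpace (Eu n) P]
  {c : OpenPartialHomeomorph P (Eu n)} {y : Eu n} {x : P}

/-- Coordinate expression of a field of endomorphisms, as a field of continuous linear maps. -/
def endoFieldIn (c : OpenPartialHomeomorph P (Eu n))
    (F : ∀ x : P, TangentSpace (𝓡 n) x →L[ℝ] TangentSpace (𝓡 n) x) (y : Eu n) : Eu n →L[ℝ] Eu n :=
  (mfderiv (𝓡 n) (𝓡 n) c (c.symm y)).comp ((F (c.symm y)).comp (mfderiv (𝓡 n) (𝓡 n) c.symm y))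

lemma endoFieldIn_apply (F : ∀ x : P, TangentSpace (𝓡 n) x →L[ℝ] TangentSpace (𝓡 n) x)
    (v : Eu n) : endoFieldIn c F y v = endoIn c F y v := rfl

lemma ofCoord_add (v w : Eu n) : ofCoord c y (v + w) = ofCoord c y v + ofCoord c y w :=
  map_add _ _ _

lemma ofCoord_neg (v : Eu n) : ofCoord c y (-v) = -ofCoord c y v := map_neg _ _

lemma ofCoord_smul (r : ℝ) (v : Eu n) : ofCoord c y (r • v) = r • ofCoord c y v := map_smul _ _ _

lemma ofCoord_zero : ofCoord c y 0 = 0 := map_zero _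

variable [IsManifold (𝓡 n) ∞ P] (hc : c ∈ atlas (Eu n) P)
include hc

lemma contMDiffOn_of_mem_atlas_smooth : ContMDiffOn (𝓡 n) (𝓡 n) ∞ c c.source :=
  contMDiffOn_of_mem_maximalAtlas (IsManifold.subset_maximalAtlas hc)

lemma contMDiffOn_symm_of_mem_atlas : ContMDiffOn (𝓡 n) (𝓡 n) ∞ c.symm c.target :=
  contMDiffOn_symm_of_mem_maximalAtlas (IsManifold.subset_maximalAtlas hc)

lemma mdifferentiableAt_symm_of_mem_atlas (hy : y ∈ c.target) :
    MDifferentiableAt (𝓡 n) (𝓡 n) c.symm y :=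
  (mdifferentiable_of_mem_atlas (I := 𝓡 n) hc).mdifferentiableAt_symm hy

lemma toCoord_ofCoord (hy : y ∈ c.target) (v : Eu n) :
    toCoord c (c.symm y) (ofCoord c y v) = v :=
  DFunLike.congr_fun ((mdifferentiable_of_mem_atlas (I := 𝓡 n) hc).comp_symm_deriv hy) v

lemma toCoord_injective (hx : x ∈ c.source) : Function.Injective (toCoord c x) :=
  (mdifferentiable_of_mem_atlas (I := 𝓡 n) hc).mfderiv_injective hx

lemma ofCoord_toCoord (hy : y ∈ c.target) (v : TangentSpace (𝓡 n) (c.symm y)) :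
    ofCoord c y (toCoord c (c.symm y) v) = v :=
  toCoord_injective hc (c.map_target hy) (toCoord_ofCoord hc hy _)

lemma ofCoord_injective (hy : y ∈ c.target) : Function.Injective (ofCoord c y) := fun v w h => by
  rw [← toCoord_ofCoord hc hy v, h, toCoord_ofCoord hc hy w]

lemma ofCoord_endoFieldIn (F : ∀ x : P, TangentSpace (𝓡 n) x →L[ℝ] TangentSpace (𝓡 n) x)
    (hy : y ∈ c.target) (v : Eu n) :
    ofCoord c y (endoFieldIn c F y v) = F (c.symm y) (ofCoord c y v) :=
  ofCoord_toCoord hc hy _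

lemma endoFieldIn_toCoord (F : ∀ x : P, TangentSpace (𝓡 n) x →L[ℝ] TangentSpace (𝓡 n) x)
    (hx : x ∈ c.source) (v : TangentSpace (𝓡 n) x) :
    endoFieldIn c F (c x) (toCoord c x v) = toCoord c x (F x v) := by
  obtain ⟨y, hy, rfl⟩ : ∃ y ∈ c.target, c.symm y = x := ⟨c x, c.map_source hx, c.left_inv hx⟩
  rw [c.right_inv hy, endoFieldIn_apply, endoIn, ofCoord_toCoord hc hy]

lemma trace_endoFieldIn (F : ∀ x : P, TangentSpace (𝓡 n) x →L[ℝ] TangentSpace (𝓡 n) x)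
    (hy : y ∈ c.target) :
    LinearMap.trace ℝ (Eu n) (endoFieldIn c F y).toLinearMap
      = LinearMap.trace ℝ (TangentSpace (𝓡 n) (c.symm y)) (F (c.symm y)).toLinearMap := by
  let T : Eu n →ₗ[ℝ] Eu n := (mfderiv (𝓡 n) (𝓡 n) c (c.symm y)).toLinearMap
  let R : Eu n →ₗ[ℝ] Eu n := (mfderiv (𝓡 n) (𝓡 n) c.symm y).toLinearMap
  let B : Eu n →ₗ[ℝ] Eu n := (F (c.symm y)).toLinearMap
  have hRT : R ∘ₗ T = LinearMap.id := LinearMap.ext fun v => ofCoord_toCoord hc hy v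
  have htrace : LinearMap.trace ℝ (Eu n) (T ∘ₗ (B ∘ₗ R)) = LinearMap.trace ℝ (Eu n) B := by
    rw [LinearMap.trace_comp_comm', LinearMap.comp_assoc, hRT, LinearMap.comp_id]
  exact htrace

lemma contMDiffOn_ofCoord (v : Eu n) :
    ContMDiffOn (𝓡 n) (𝓡 n).tangent ∞
      (fun y => (⟨c.symm y, ofCoord c y v⟩ : TangentBundle (𝓡 n) P)) c.target := by
  have hsymm := (contMDiffOn_symm_of_mem_atlas hc).contMDiffOn_tangentMapWithin (m := ∞) (by simp)
    c.open_target.uniqueMDiffOn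
  have hconst : ContMDiffOn (𝓡 n) (𝓡 n).tangent ∞
      (fun y : Eu n => (⟨y, v⟩ : TangentBundle (𝓡 n) (Eu n))) c.target :=
    contMDiffOn_vectorSpace_iff_contDiffOn.2 contDiffOn_const
  refine (hsymm.comp hconst fun y hy => hy).congr fun y hy => ?_
  simp only [Function.comp_apply, tangentMapWithin]
  rw [mfderivWithin_of_isOpen c.open_target hy]
  rfl

lemma contDiffOn_toCoord {Z : ∀ y : Eu n, TangentSpace (𝓡 n) (c.symm y)}
    (hZ : ContMDiffOn (𝓡 n) (𝓡 n).tangent ∞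
      (fun y => (⟨c.symm y, Z y⟩ : TangentBundle (𝓡 n) P)) c.target) :
    ContDiffOn ℝ ∞ (fun y => toCoord c (c.symm y) (Z y)) c.target := by
  have hchart := (contMDiffOn_of_mem_atlas_smooth hc).contMDiffOn_tangentMapWithin (m := ∞)
    (by simp) c.open_source.uniqueMDiffOn
  have hcomp := (contMDiff_snd_tangentBundle_modelSpace (n := ∞) (Eu n) (𝓡 n)).comp_contMDiffOn
    (hchart.comp hZ fun y hy => c.map_target hy)
  refine (contMDiffOn_iff_contDiffOn.1 hcomp).congr fun y hy => ?_
  change toCoord c (c.symm y) (Z y) = mfderivWithin (𝓡 n) (𝓡 n) c c.source (c.symm y) (Z y)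
  rw [mfderivWithin_of_isOpen c.open_source (c.map_target hy)]
  rfl

lemma contDiffOn_endoFieldIn {F : ∀ x : P, TangentSpace (𝓡 n) x →L[ℝ] TangentSpace (𝓡 n) x}
    (hF : ContMDiff (𝓡 n) ((𝓡 n).prod 𝓘(ℝ, Eu n →L[ℝ] Eu n)) ∞
      (fun x => Bundle.TotalSpace.mk' (Eu n →L[ℝ] Eu n)
        (E := fun x : P => TangentSpace (𝓡 n) x →L[ℝ] TangentSpace (𝓡 n) x) x (F x))) :
    ContDiffOn ℝ ∞ (endoFieldIn c F) c.target := by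
  refine contDiffOn_clm_apply.2 fun v =>
    contDiffOn_toCoord hc (Z := fun y => F (c.symm y) (ofCoord c y v)) fun y hy => ?_
  apply ContMDiffWithinAt.clm_bundle_apply (F₁ := Eu n) (F₂ := Eu n)
  · exact hF.contMDiffAt.comp_contMDiffWithinAt y (contMDiffOn_symm_of_mem_atlas hc y hy)
  · exact contMDiffOn_ofCoord hc v y hy

namespace ContactData

variable (S : ContactData n P)

omit hc in
/-- Coordinate expression of the metric, as a field of continuous bilinear forms. -/
def metricIn (c : OpenPartialHomeomorph P (Eu n)) (y : Eu n) : Eu n →L[ℝ] Eu n →L[ℝ] ℝ :=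
  ContinuousLinearMap.bilinearComp (E := Eu n) (F := Eu n) (S.g.inner (c.symm y))
    (mfderiv (𝓡 n) (𝓡 n) c.symm y) (mfderiv (𝓡 n) (𝓡 n) c.symm y)

omit hc in
lemma metricIn_apply (v w : Eu n) :
    S.metricIn c y v w = S.g.inner (c.symm y) (ofCoord c y v) (ofCoord c y w) := rfl

omit hc in
lemma ξIn_chart (hx : x ∈ c.source) : S.ξIn c (c x) = toCoord c x (S.ξ x) := by
  rw [ξIn, c.left_inv hx]

lemma ofCoord_ξIn (hy : y ∈ c.target) : ofCoord c y (S.ξIn c y) = S.ξ (c.symm y) :=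
  ofCoord_toCoord hc hy _

lemma metricIn_toCoord (hx : x ∈ c.source) (v w : TangentSpace (𝓡 n) x) :
    S.metricIn c (c x) (toCoord c x v) (toCoord c x w) = S.g.inner x v w := by
  obtain ⟨y, hy, rfl⟩ : ∃ y ∈ c.target, c.symm y = x := ⟨c x, c.map_source hx, c.left_inv hx⟩
  rw [c.right_inv hy, metricIn_apply, ofCoord_toCoord hc hy, ofCoord_toCoord hc hy]

lemma contDiffOn_metricIn : ContDiffOn ℝ ∞ (S.metricIn c) c.target := by
  refine contDiffOn_clm_apply.2 fun v => contDiffOn_clm_apply.2 fun w => ?_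
  have h : ContMDiffOn (𝓡 n) ((𝓡 n).prod 𝓘(ℝ)) ∞ (fun y => Bundle.TotalSpace.mk' ℝ
      (E := Bundle.Trivial P ℝ) (c.symm y)
        (S.g.inner (c.symm y) (ofCoord c y v) (ofCoord c y w))) c.target := by
    intro y hy
    apply ContMDiffWithinAt.clm_bundle_apply₂ (F₁ := Eu n) (F₂ := Eu n)
    · exact S.g.contMDiff.contMDiffAt.comp_contMDiffWithinAt y
        (contMDiffOn_symm_of_mem_atlas hc y hy)
    · exact contMDiffOn_ofCoord hc v y hy
    · exact contMDiffOn_ofCoord hc w y hy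
  exact contMDiffOn_iff_contDiffOn.1 fun y hy =>
    (Bundle.contMDiffWithinAt_totalSpace.1 (h y hy)).2

lemma contDiffOn_ξIn : ContDiffOn ℝ ∞ (S.ξIn c) c.target :=
  contDiffOn_toCoord hc (Z := fun y => S.ξ (c.symm y)) fun y hy =>
    S.smooth_ξ.contMDiffAt.comp_contMDiffWithinAt y (contMDiffOn_symm_of_mem_atlas hc y hy)

lemma metricIn_pos (hy : y ∈ c.target) {v : Eu n} (hv : v ≠ 0) : 0 < S.metricIn c y v v :=
  S.g.pos _ _ fun h => hv (ofCoord_injective hc hy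
    (h.trans ofCoord_zero.symm))

lemma isPseudoMetric_metricIn : IsPseudoMetric c.target (S.metricIn c) where
  isOpen := c.open_target
  smooth := S.contDiffOn_metricIn hc
  symm _ _ _ _ := S.g.symm _ _ _
  isInvertible _ hy := isInvertible_of_pos fun _ hv => S.metricIn_pos hc hy hv

variable {S}

lemma IsAlmostContactMetric.metricIn_ξIn (hS : S.IsAlmostContactMetric) (hy : y ∈ c.target)
    (v : Eu n) : S.metricIn c y (S.ξIn c y) v = S.ηIn c y v := by
  rw [metricIn_apply, S.ofCoord_ξIn hc hy, ← hS.η_eq, ηIn]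

lemma christoffel_gIn (hy : y ∈ c.target) (v w : Eu n) :
    christoffel (S.gIn c) y v w = leviCivita (S.metricIn c) y v w :=
  christoffel_eq (S.isPseudoMetric_metricIn hc).isLeviCivita (S.isPseudoMetric_metricIn hc)
    (fun _ _ _ _ => rfl) hy v w

lemma IsSasakian.sasakianChart (hS : S.IsSasakian) : SasakianChart c.target (S.metricIn c)
    (leviCivita (S.metricIn c)) (endoFieldIn c S.φ) (S.ξIn c) where
  isOpen := c.open_target
  smooth_g := S.contDiffOn_metricIn hc
  smooth_φ := contDiffOn_endoFieldIn hc S.smooth_φ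
  smooth_ξ := S.contDiffOn_ξIn hc
  symm := (S.isPseudoMetric_metricIn hc).symm
  pos _ hy _ hv := S.metricIn_pos hc hy hv
  unit_ξ y hy := by rw [hS.metricIn_ξIn hc hy, ηIn, S.ofCoord_ξIn hc hy, hS.η_ξ]
  φ_ξ y hy := ofCoord_injective hc hy <| by
    rw [ofCoord_endoFieldIn hc _ hy, S.ofCoord_ξIn hc hy, hS.φ_ξ, ofCoord_zero]
  φ_sq y hy v := ofCoord_injective hc hy <| by
    rw [ofCoord_endoFieldIn hc _ hy, ofCoord_endoFieldIn hc _ hy, hS.φ_sq,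
      ofCoord_add, ofCoord_neg, ofCoord_smul, hS.metricIn_ξIn hc hy, S.ofCoord_ξIn hc hy, ηIn]
  g_φ y hy v w := by
    rw [hS.metricIn_ξIn hc hy, hS.metricIn_ξIn hc hy, metricIn_apply, ofCoord_endoFieldIn hc _ hy,
      ofCoord_endoFieldIn hc _ hy, hS.g_φ]
    rfl
  isLeviCivita := (S.isPseudoMetric_metricIn hc).isLeviCivita
  cov_φ y hy v w := by
    have hφ : DifferentiableAt ℝ (endoFieldIn c S.φ) y :=
      ((contDiffOn_endoFieldIn hc S.smooth_φ).contDiffAt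
        (c.open_target.mem_nhds hy)).differentiableAt (by simp)
    have hfderiv : fderiv ℝ (fun z => endoIn c S.φ z w) y v
        = fderiv ℝ (endoFieldIn c S.φ) y v w := by
      refine (fderiv_clm_apply_apply hφ (differentiableAt_const w) v).trans ?_
      rw [fderiv_fun_const, Pi.zero_apply, _root_.zero_apply, map_zero, add_zero]
    have h := hS.cov_φ c hc y hy v w
    rw [cov, christoffel_gIn hc hy, christoffel_gIn hc hy, hfderiv] at h
    rw [(S.isPseudoMetric_metricIn hc).symm y hy (S.ξIn c y)]
    exact h

lemma IsSasakianSpaceForm.spaceFormChart {κ : ℝ} (hS : S.IsSasakianSpaceForm κ) :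
    SpaceFormChart c.target (S.metricIn c) (leviCivita (S.metricIn c)) (endoFieldIn c S.φ)
      (S.ξIn c) κ where
  toSasakianChart := hS.sasakianChart hc
  curvature y hy u v w := by
    have hΓ := (S.isPseudoMetric_metricIn hc).isLeviCivita
    rw [← riemann_eq_curv c.open_target hΓ.smooth (fun _ hy => christoffel_gIn hc hy) hy,
      hS.curvature c hc y hy]
    simp only [hS.metricIn_ξIn hc hy]
    rfl

end ContactData

end Charts

section Immersions

variable {n k : ℕ} {P : Type*} [TopologicalSpace P] [ChartedSpace (Eu n) P]
  [IsManifold (𝓡 n) ∞ P] {M : Type*} [TopologicalSpace M] [ChartedSpace (Eu k) M]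
  [IsManifold (𝓡 k) ∞ M] {c : OpenPartialHomeomorph M (Eu k)} {d : OpenPartialHomeomorph P (Eu n)}
  {ψ : M → P}

lemma contDiffOn_mapIn (hψ : ContMDiff (𝓡 k) (𝓡 n) ∞ ψ) (hc : c ∈ atlas (Eu k) M)
    (hd : d ∈ atlas (Eu n) P) : ContDiffOn ℝ ∞ (mapIn c d ψ) (domIn c d ψ) :=
  contMDiffOn_iff_contDiffOn.1 <| (contMDiffOn_of_mem_atlas_smooth hd).comp
    (hψ.comp_contMDiffOn ((contMDiffOn_symm_of_mem_atlas hc).mono fun _ h => h.1)) fun _ h => h.2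

omit [ChartedSpace (Eu n) P] [IsManifold (𝓡 n) ∞ P] [ChartedSpace (Eu k) M]
  [IsManifold (𝓡 k) ∞ M] in
lemma isOpen_domIn (hψ : Continuous ψ) : IsOpen (domIn c d ψ) :=
  (hψ.comp_continuousOn c.continuousOn_symm).isOpen_inter_preimage c.open_target d.open_source

lemma fderiv_mapIn (hψ : ContMDiff (𝓡 k) (𝓡 n) ∞ ψ) (hc : c ∈ atlas (Eu k) M)
    (hd : d ∈ atlas (Eu n) P) {t : Eu k} (ht : t ∈ domIn c d ψ) (v : Eu k) :
    fderiv ℝ (mapIn c d ψ) t v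
      = toCoord d (ψ (c.symm t)) (mfderiv (𝓡 k) (𝓡 n) ψ (c.symm t) (ofCoord c t v)) := by
  have hcs := mdifferentiableAt_symm_of_mem_atlas hc ht.1
  have hψt : MDifferentiableAt (𝓡 k) (𝓡 n) ψ (c.symm t) := hψ.mdifferentiableAt (by simp)
  have hdt : MDifferentiableAt (𝓡 n) (𝓡 n) d (ψ (c.symm t)) :=
    (mdifferentiable_of_mem_atlas hd).mdifferentiableAt ht.2
  have hmap : mapIn c d ψ = d ∘ ψ ∘ c.symm := rfl
  rw [← mfderiv_eq_fderiv, hmap, mfderiv_comp t (g := d) (f := ψ ∘ c.symm) hdt (hψt.comp t hcs),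
    mfderiv_comp t (g := ψ) hψt hcs]
  rfl

lemma IsSmoothImmersion.immersionChart (hψ : IsSmoothImmersion (k := k) (n := n) ψ)
    (hc : c ∈ atlas (Eu k) M) (hd : d ∈ atlas (Eu n) P) :
    ImmersionChart d.target (domIn c d ψ) (mapIn c d ψ) where
  isOpen := isOpen_domIn hψ.1.continuous
  maps _ h := d.map_source h.2
  smooth := contDiffOn_mapIn hψ.1 hc hd
  injective t ht v w h := by
    rw [fderiv_mapIn hψ.1 hc hd ht, fderiv_mapIn hψ.1 hc hd ht] at h
    exact ofCoord_injective hc ht.1 (hψ.2 _ (toCoord_injective hd ht.2 h))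

end Immersions

lemma fderiv_eq_zero_of_eventuallyEq_abs {E : Type*} [NormedAddCommGroup E] [NormedSpace ℝ E]
    {ρ h : E → ℝ} {u w : E} (hρ : DifferentiableAt ℝ ρ u) (hh : DifferentiableAt ℝ h u)
    (habs : ρ =ᶠ[nhds u] fun t => |h t|) (hw : fderiv ℝ h u w = 0) : fderiv ℝ ρ u w = 0 := by
  have hu : ρ u = |h u| := habs.self_of_nhds
  by_cases h0 : h u = 0
  · have hmin : IsLocalMin ρ u := by
      filter_upwards [habs] with t ht
      rw [ht, hu, h0, abs_zero]
      exact abs_nonneg _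
    rw [hmin.fderiv_eq_zero, _root_.zero_apply]
  · have hsq : (fun t => ρ t * ρ t) =ᶠ[nhds u] fun t => h t * h t := by
      filter_upwards [habs] with t ht
      rw [ht, abs_mul_abs_self]
    have hfderiv := congrArg (fun L : E →L[ℝ] ℝ => L w) (hsq.fderiv_eq (𝕜 := ℝ))
    simp only [fderiv_fun_mul hρ hρ, fderiv_fun_mul hh hh, _root_.add_apply, _root_.smul_apply,
      smul_eq_mul, hw, mul_zero, add_zero] at hfderiv
    have hne : ρ u ≠ 0 := by rw [hu]; exact abs_ne_zero.2 h0
    exact (mul_eq_zero.1 (by linarith : ρ u * fderiv ℝ ρ u w = 0)).resolve_left hne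

section ScalarFunctions

variable {k : ℕ} {M : Type*} [TopologicalSpace M] [ChartedSpace (Eu k) M] [IsManifold (𝓡 k) ∞ M]
  {c : OpenPartialHomeomorph M (Eu k)} {ρ : M → ℝ} {t : Eu k}

lemma differentiableAt_comp_symm (hc : c ∈ atlas (Eu k) M) (ht : t ∈ c.target)
    (hρ : MDifferentiableAt (𝓡 k) 𝓘(ℝ, ℝ) ρ (c.symm t)) :
    DifferentiableAt ℝ (fun s => ρ (c.symm s)) t :=
  mdifferentiableAt_iff_differentiableAt.1
    (hρ.comp t (mdifferentiableAt_symm_of_mem_atlas hc ht))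

lemma mfderiv_ofCoord (hc : c ∈ atlas (Eu k) M) (ht : t ∈ c.target)
    (hρ : MDifferentiableAt (𝓡 k) 𝓘(ℝ, ℝ) ρ (c.symm t)) (x : Eu k) :
    mfderiv (𝓡 k) 𝓘(ℝ, ℝ) ρ (c.symm t) (ofCoord c t x) = fderiv ℝ (fun s => ρ (c.symm s)) t x := by
  rw [← mfderiv_eq_fderiv]
  exact (DFunLike.congr_fun
    (mfderiv_comp t (g := ρ) hρ (mdifferentiableAt_symm_of_mem_atlas hc ht)) x).symm

lemma isLocallyConstant_of_mfderiv_eq_zero (hρ : ∀ p, MDifferentiableAt (𝓡 k) 𝓘(ℝ, ℝ) ρ p)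
    (hzero : ∀ (p : M) (v : TangentSpace (𝓡 k) p), mfderiv (𝓡 k) 𝓘(ℝ, ℝ) ρ p v = 0) :
    IsLocallyConstant ρ := by
  refine (IsLocallyConstant.iff_eventually_eq ρ).2 fun p => ?_
  set c := chartAt (Eu k) p
  have hc : c ∈ atlas (Eu k) M := chart_mem_atlas _ _
  have hp : p ∈ c.source := mem_chart_source _ _
  obtain ⟨r, hr, hball⟩ := Metric.isOpen_iff.1 c.open_target (c p) (c.map_source hp)
  have hconst : ∀ t ∈ Metric.ball (c p) r, ρ (c.symm t) = ρ (c.symm (c p)) := fun t ht =>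
    Metric.isOpen_ball.is_const_of_fderiv_eq_zero (𝕜 := ℝ) (f := fun s => ρ (c.symm s))
      (convex_ball (c p) r).isPreconnected
      (fun s hs => (differentiableAt_comp_symm hc (hball hs) (hρ _)).differentiableWithinAt)
      (fun s hs => by
        ext1 x
        exact (mfderiv_ofCoord hc (hball hs) (hρ _) x).symm.trans (hzero _ _))
      ht (Metric.mem_ball_self hr)
  filter_upwards [c.open_source.mem_nhds hp,
    (c.continuousAt hp).eventually (Metric.ball_mem_nhds _ hr)] with q hq hq_ball
  rw [← c.left_inv hq, hconst (c q) hq_ball, c.left_inv hp]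

end ScalarFunctions

section Hypersurfaces

variable {n k : ℕ} {P : Type*} [TopologicalSpace P] [ChartedSpace (Eu n) P]
  [IsManifold (𝓡 n) ∞ P] {S : ContactData n P}
  {M : Type*} [TopologicalSpace M] [ChartedSpace (Eu k) M]
  {c : OpenPartialHomeomorph M (Eu k)} {d : OpenPartialHomeomorph P (Eu n)} {ψ : M → P}
  {N : ∀ p : M, TangentSpace (𝓡 n) (ψ p)}
  {A : ∀ p : M, TangentSpace (𝓡 k) p →L[ℝ] TangentSpace (𝓡 k) p}
  {O : Set (Eu k)} {ν : Eu k → Eu n} {t u : Eu k} {s : ℝ}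

omit [IsManifold (𝓡 n) ∞ P] in
lemma exists_mem_domIn (ψ : M → P) (p : M) :
    ∃ c ∈ atlas (Eu k) M, ∃ d ∈ atlas (Eu n) P, ∃ u ∈ domIn c d ψ, c.symm u = p := by
  have hp : (chartAt (Eu k) p).symm (chartAt (Eu k) p p) = p :=
    (chartAt (Eu k) p).left_inv (mem_chart_source _ p)
  refine ⟨chartAt _ p, chart_mem_atlas _ _, chartAt _ (ψ p), chart_mem_atlas _ _,
    chartAt (Eu k) p p, ⟨mem_chart_target _ p, ?_⟩, hp⟩
  rw [hp]
  exact mem_chart_source _ (ψ p)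

lemma IsUnitNormal.alongIn_unit (hN : IsUnitNormal (k := k) S ψ N) (hd : d ∈ atlas (Eu n) P)
    (ht : t ∈ domIn c d ψ) :
    S.metricIn d (mapIn c d ψ t) (alongIn c d ψ N t) (alongIn c d ψ N t) = 1 := by
  rw [mapIn, alongIn, S.metricIn_toCoord hd ht.2, (hN _).1]

variable [IsManifold (𝓡 k) ∞ M]

lemma IsUnitNormal.alongIn_normal (hN : IsUnitNormal (k := k) S ψ N)
    (hψ : IsSmoothImmersion (k := k) (n := n) ψ) (hc : c ∈ atlas (Eu k) M)
    (hd : d ∈ atlas (Eu n) P) (ht : t ∈ domIn c d ψ) (v : Eu k) :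
    S.metricIn d (mapIn c d ψ t) (alongIn c d ψ N t) (fderiv ℝ (mapIn c d ψ) t v) = 0 := by
  rw [fderiv_mapIn hψ.1 hc hd ht, mapIn, alongIn, S.metricIn_toCoord hd ht.2, (hN _).2]

lemma IsSmoothImmersion.exists_contactHypersurface (hψ : IsSmoothImmersion (k := k) (n := n) ψ)
    (hn : n = k + 1) (hN : IsUnitNormal (k := k) S ψ N)
    (hξ : ∀ p : M, ∃ v : TangentSpace (𝓡 k) p, mfderiv (𝓡 k) (𝓡 n) ψ p v = S.ξ (ψ p))
    (hc : c ∈ atlas (Eu k) M) (hd : d ∈ atlas (Eu n) P) (hu : u ∈ domIn c d ψ) :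
    ∃ O ⊆ domIn c d ψ, u ∈ O ∧ ∃ ν,
      ContactHypersurface d.target (S.metricIn d) (S.ξIn d) O (mapIn c d ψ) ν ∧
        ν u = alongIn c d ψ N u := by
  refine (hψ.immersionChart hc hd).exists_contactHypersurface (by simp [hn])
    (S.isPseudoMetric_metricIn hd) (fun _ hy _ hv => S.metricIn_pos hd hy hv) (fun t ht => ?_) hu
    (hN.alongIn_unit hd hu) (hN.alongIn_normal hψ hc hd hu)
  obtain ⟨v, hv⟩ := hξ (c.symm t)
  refine ⟨toCoord c (c.symm t) v, ?_⟩
  rw [fderiv_mapIn hψ.1 hc hd ht, ofCoord_toCoord hc ht.1, hv, mapIn, S.ξIn_chart ht.2]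

section LocalNormal

variable (hψ : IsSmoothImmersion (k := k) (n := n) ψ) (hc : c ∈ atlas (Eu k) M)
  (hd : d ∈ atlas (Eu n) P) (hO : O ⊆ domIn c d ψ)
  (F : ContactHypersurface d.target (S.metricIn d) (S.ξIn d) O (mapIn c d ψ) ν)
include hψ hc hd hO F

namespace IsShapeOperator

variable (hA : IsShapeOperator S ψ N A) (hN : IsUnitNormal (k := k) S ψ N) (hS : S.IsSasakian)
include hA hN hS

lemma exists_alongIn_eq_smul (ht : t ∈ O) :
    ∃ s : ℝ, s * s = 1 ∧ alongIn c d ψ N t = s • ν t ∧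
      endoFieldIn c A t
        = s • weingarten (S.metricIn d) (leviCivita (S.metricIn d)) (mapIn c d ψ) ν t := by
  obtain ⟨s, hs, hNs⟩ := F.exists_eq_smul_normal ht (hN.alongIn_unit hd (hO ht))
    (hN.alongIn_normal hψ hc hd (hO ht))
  refine ⟨s, hs, hNs, F.eq_smul_weingarten (hS.sasakianChart hd) ht fun v x => ?_⟩
  rw [← covAlong_eq_covDeriv (fun _ hy => ContactData.christoffel_gIn hd hy) (F.maps t ht), ← hNs]
  exact hA c hc d hd t (hO ht) v x

lemma alongIn_meanCurv (ht : t ∈ O) :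
    alongIn c d ψ (meanCurv ψ N A) t
      = meanCurvature (S.metricIn d) (leviCivita (S.metricIn d)) (mapIn c d ψ) ν t • ν t := by
  obtain ⟨s, hs, hNs, hAs⟩ := hA.exists_alongIn_eq_smul hψ hc hd hO F hN hS ht
  have hsmul : alongIn c d ψ (meanCurv ψ N A) t
      = (1 / (k : ℝ) * LinearMap.trace ℝ (TangentSpace (𝓡 k) (c.symm t))
          (A (c.symm t)).toLinearMap) • alongIn c d ψ N t := map_smul _ _ _
  rw [hsmul, hNs, ← trace_endoFieldIn hc A (hO ht).1, hAs, ContinuousLinearMap.toLinearMap_smul,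
    map_smul, smul_eq_mul, smul_smul, meanCurvature, finrank_euclideanSpace_fin]
  congr 1
  linear_combination (1 / (k : ℝ) * LinearMap.trace ℝ (Eu k) (weingarten (S.metricIn d)
    (leviCivita (S.metricIn d)) (mapIn c d ψ) ν t).toLinearMap) * hs

lemma normH_symm (ht : t ∈ O) :
    normH S ψ N A (c.symm t)
      = |meanCurvature (S.metricIn d) (leviCivita (S.metricIn d)) (mapIn c d ψ) ν t| := by
  have hH := hA.alongIn_meanCurv hψ hc hd hO F hN hS ht
  rw [normH, ← S.metricIn_toCoord hd (hO ht).2, ← Real.sqrt_mul_self_eq_abs]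
  change √(S.metricIn d (mapIn c d ψ t) (alongIn c d ψ (meanCurv ψ N A) t)
    (alongIn c d ψ (meanCurv ψ N A) t)) = _
  rw [hH, map_smul, map_smul, _root_.smul_apply, F.unit t ht, smul_eq_mul, smul_eq_mul, mul_one]

lemma mfderiv_normH_ofCoord (hu : u ∈ O)
    (hρ : MDifferentiableAt (𝓡 k) 𝓘(ℝ, ℝ) (normH S ψ N A) (c.symm u)) {x : Eu k}
    (hx : fderiv ℝ (meanCurvature (S.metricIn d) (leviCivita (S.metricIn d)) (mapIn c d ψ) ν) u x
      = 0) :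
    mfderiv (𝓡 k) 𝓘(ℝ, ℝ) (normH S ψ N A) (c.symm u) (ofCoord c u x) = 0 := by
  rw [mfderiv_ofCoord hc (hO hu).1 hρ]
  refine fderiv_eq_zero_of_eventuallyEq_abs (differentiableAt_comp_symm hc (hO hu).1 hρ)
    ((F.contDiffAt_meanCurvature (hS.sasakianChart hd) hu).differentiableAt (by simp)) ?_ hx
  filter_upwards [F.isOpen.mem_nhds hu] with t ht using hA.normH_symm hψ hc hd hO F hN hS ht

end IsShapeOperator

lemma mfderiv_ofCoord_tangentξ (hS : S.IsSasakian) (hu : u ∈ O) :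
    mfderiv (𝓡 k) (𝓡 n) ψ (c.symm u)
      (ofCoord c u (tangentξ (S.metricIn d) (S.ξIn d) (mapIn c d ψ) u)) = S.ξ (ψ (c.symm u)) :=
  toCoord_injective hd (hO hu).2 <| by
    rw [← fderiv_mapIn hψ.1 hc hd (hO hu), F.fderiv_tangentξ (hS.sasakianChart hd) hu, mapIn,
      S.ξIn_chart (hO hu).2]

lemma mfderiv_ofCoord_tangentV (hS : S.IsSasakian) (hu : u ∈ O)
    (hν : ν u = alongIn c d ψ N u) :
    mfderiv (𝓡 k) (𝓡 n) ψ (c.symm u)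
        (ofCoord c u (tangentV (S.metricIn d) (endoFieldIn d S.φ) (mapIn c d ψ) ν u))
      = structV S ψ N (c.symm u) :=
  toCoord_injective hd (hO hu).2 <| by
    rw [← fderiv_mapIn hψ.1 hc hd (hO hu), F.fderiv_tangentV (hS.sasakianChart hd) hu, hν, mapIn,
      alongIn, endoFieldIn_toCoord hd S.φ (hO hu).2]
    exact (map_neg _ _).symm

lemma fderiv_meanCurvature_tangentV {κ : ℝ} (hS : S.IsSasakianSpaceForm κ)
    (hric : S.RicciNondegenerate) (hn : n = k + 1) (hN : IsUnitNormal (k := k) S ψ N)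
    (hA : IsShapeOperator S ψ N A) (hbi : IsRicciBiharmonic S ψ N A) (hu : u ∈ O) :
    fderiv ℝ (meanCurvature (S.metricIn d) (leviCivita (S.metricIn d)) (mapIn c d ψ) ν) u
      (tangentV (S.metricIn d) (endoFieldIn d S.φ) (mapIn c d ψ) ν u) = 0 := by
  have hSd := hS.spaceFormChart hd
  have := F.nontrivial hSd.toSasakianChart hu
  have hk : 0 < k := by simpa using Module.finrank_pos (R := ℝ) (M := Eu k)
  have hH : alongIn c d ψ (meanCurv ψ N A) =ᶠ[nhds u] fun t =>
      meanCurvature (S.metricIn d) (leviCivita (S.metricIn d)) (mapIn c d ψ) ν t • ν t := by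
    filter_upwards [F.isOpen.mem_nhds hu] with t ht
      using hA.alongIn_meanCurv hψ hc hd hO F hN hS.toIsSasakian ht
  have hη := F.η_bitension (G := S.gIn d) hSd (fun _ _ _ _ => rfl) (by omega) (hric d hd) hu
    (F.contDiffAt_meanCurvature hSd.toSasakianChart hu)
  obtain ⟨b, hb⟩ : ∃ b,
      bitension (S.gIn d) (mapIn c d ψ) (alongIn c d ψ (meanCurv ψ N A)) b u = 0 :=
    hbi.elim (fun h => ⟨_, h c hc d hd u (hO hu)⟩) fun h => ⟨_, h c hc d hd u (hO hu)⟩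
  rw [bitension_congr hH] at hb
  have hηb := hη b
  rw [hb, map_zero] at hηb
  linarith

end LocalNormal

end Hypersurfaces

section Frame

variable {n k : ℕ} {P : Type*} [TopologicalSpace P] [ChartedSpace (Eu n) P]
  [IsManifold (𝓡 n) ∞ P] {S : ContactData n P}
  {M : Type*} [TopologicalSpace M] [ChartedSpace (Eu k) M]
  {ψ : M → P} {N : ∀ p : M, TangentSpace (𝓡 n) (ψ p)}

namespace ContactData.IsAlmostContactMetric

variable (hS : S.IsAlmostContactMetric)
include hS

lemma η_φ (x : P) (v : TangentSpace (𝓡 n) x) : S.η x (S.φ x v) = 0 := by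
  have h := hS.φ_sq x (S.φ x v)
  rw [hS.φ_sq x v, map_add, map_neg, map_smul, hS.φ_ξ, smul_zero, add_zero] at h
  have hη := congrArg (S.η x) (left_eq_add.1 h)
  rwa [map_smul, map_zero, hS.η_ξ, smul_eq_mul, mul_one] at hη

lemma inner_ξ_self (x : P) : S.g.inner x (S.ξ x) (S.ξ x) = 1 := by
  rw [← hS.η_eq, hS.η_ξ]

omit [TopologicalSpace M] in
lemma inner_ξ_structV (p : M) : S.g.inner (ψ p) (S.ξ (ψ p)) (structV S ψ N p) = 0 := by
  rw [← hS.η_eq, structV, map_neg, hS.η_φ, neg_zero]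

lemma inner_structV_self (hN : IsUnitNormal (k := k) S ψ N) {p : M}
    (hξ : ∃ v : TangentSpace (𝓡 k) p, mfderiv (𝓡 k) (𝓡 n) ψ p v = S.ξ (ψ p)) :
    S.g.inner (ψ p) (structV S ψ N p) (structV S ψ N p) = 1 := by
  obtain ⟨v, hv⟩ := hξ
  have hηN : S.η (ψ p) (N p) = 0 := by
    rw [hS.η_eq, S.g.symm, ← hv, (hN p).2]
  rw [structV, map_neg, map_neg, _root_.neg_apply, neg_neg, hS.g_φ, (hN p).1, hηN, mul_zero,
    sub_zero]

end ContactData.IsAlmostContactMetric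

end Frame

theorem mainTheorem4_general {k : ℕ} {κ : ℝ}
    {P : Type*} [TopologicalSpace P] [ChartedSpace (Eu (k + 1)) P] [IsManifold (𝓡 (k + 1)) ∞ P]
    {S : ContactData (k + 1) P} (hS : S.IsSasakianSpaceForm κ) (hric : S.RicciNondegenerate)
    {M : Type*} [TopologicalSpace M] [ChartedSpace (Eu k) M] [IsManifold (𝓡 k) ∞ M]
    {ψ : M → P} (hψ : IsSmoothImmersion (k := k) (n := k + 1) ψ)
    {N : ∀ p : M, TangentSpace (𝓡 (k + 1)) (ψ p)}
    {A : ∀ p : M, TangentSpace (𝓡 k) p →L[ℝ] TangentSpace (𝓡 k) p}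
    (hN : IsUnitNormal (k := k) S ψ N) (hA : IsShapeOperator S ψ N A)
    (hξ : ∀ p : M, ∃ v : TangentSpace (𝓡 k) p, mfderiv (𝓡 k) (𝓡 (k + 1)) ψ p v = S.ξ (ψ p))
    (hbi : IsRicciBiharmonic S ψ N A) {α β : M → ℝ}
    (hgrad : IsGradNormH S ψ N A (fun p => α p • S.ξ (ψ p) + β p • structV S ψ N p)) :
    (∀ p, α p = 0 ∧ β p = 0) ∧ IsLocallyConstant (normH S ψ N A) := by
  have hzero : ∀ p, α p = 0 ∧ β p = 0 := fun p => by
    obtain ⟨c, hc, d, hd, u, hu, rfl⟩ := exists_mem_domIn (k := k) (n := k + 1) ψ p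
    obtain ⟨O, hO, huO, ν, F, hν⟩ := hψ.exists_contactHypersurface rfl hN hξ hc hd hu
    have hdξ := hA.mfderiv_normH_ofCoord hψ hc hd hO F hN hS.toIsSasakian huO (hgrad _).1
      (F.fderiv_meanCurvature_tangentξ (hS.spaceFormChart hd) huO)
    have hdV := hA.mfderiv_normH_ofCoord hψ hc hd hO F hN hS.toIsSasakian huO (hgrad _).1
      (fderiv_meanCurvature_tangentV hψ hc hd hO F hS hric rfl hN hA hbi huO)
    rw [(hgrad _).2, mfderiv_ofCoord_tangentξ hψ hc hd hO F hS.toIsSasakian huO] at hdξ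
    rw [(hgrad _).2, mfderiv_ofCoord_tangentV hψ hc hd hO F hS.toIsSasakian huO hν] at hdV
    simp only [map_add, map_smul, _root_.add_apply, _root_.smul_apply, smul_eq_mul,
      hS.inner_ξ_self, hS.inner_ξ_structV, hS.inner_structV_self hN (hξ _), S.g.symm _ (structV ..),
      mul_one, mul_zero, add_zero, zero_add] at hdξ hdV
    exact ⟨hdξ, hdV⟩
  refine ⟨hzero, isLocallyConstant_of_mfderiv_eq_zero (fun p => (hgrad p).1) fun p v => ?_⟩
  refine ((hgrad p).2 v).trans ?_
  simp only [(hzero p).1, (hzero p).2, zero_smul, add_zero, map_zero, _root_.zero_apply]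
  rfl

end

theorem mainTheorem4 :
    ∃ m₀ : ℕ, ∀ (m : ℕ), 1 ≤ m → ∀ (c : ℝ)
      (P : Type*) [TopologicalSpace P] [ChartedSpace (Eu (2 * m + 1)) P]
      [IsManifold (𝓡 (2 * m + 1)) ∞ P]
      (S : ContactData (2 * m + 1) P), S.IsSasakianSpaceForm c → S.RicciNondegenerate →
    ∀ (M : Type*) [TopologicalSpace M] [ChartedSpace (Eu (2 * m)) M]
      [IsManifold (𝓡 (2 * m)) ∞ M]
      (ψ : M → P), IsSmoothImmersion (k := 2 * m) (n := 2 * m + 1) ψ →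
    ∀ (N : ∀ p : M, TangentSpace (𝓡 (2 * m + 1)) (ψ p))
      (A : ∀ p : M, TangentSpace (𝓡 (2 * m)) p →L[ℝ] TangentSpace (𝓡 (2 * m)) p),
      IsUnitNormal (k := 2 * m) S ψ N → IsShapeOperator S ψ N A →
      IsPseudoHopf S ψ N A → IsRicciBiharmonic S ψ N A →
    ∀ (α β : M → ℝ),
      IsGradNormH S ψ N A (fun p => α p • S.ξ (ψ p) + β p • structV S ψ N p) →
      -- if `α = 0`, the mean curvature is constant
      (ConnectedSpace M → (∀ p, α p = 0) → ∃ κ : ℝ, ∀ p, normH S ψ N A p = κ) ∧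
      -- nonexistence for `α ≠ 0`, large dimension and `c > 1`
      (m₀ ≤ m → 1 < c → ¬ ∃ p, α p ≠ 0) ∧
      -- the formula for `|H|` where `α ≠ 0` and `γ₁ + γ₂ ≠ 0`
      (∀ (p : M) (θ γ₁ γ₂ : ℝ) (W₁ W₂ : TangentSpace (𝓡 (2 * m)) p),
        α p ≠ 0 →
        meanCurv ψ N A p = normH S ψ N A p • N p →
        0 < θ → θ < Real.pi / 2 →
        mfderiv (𝓡 (2 * m)) (𝓡 (2 * m + 1)) ψ p W₁
          = Real.cos θ • S.ξ (ψ p) + Real.sin θ • structV S ψ N p →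
        mfderiv (𝓡 (2 * m)) (𝓡 (2 * m + 1)) ψ p W₂
          = -(Real.sin θ • S.ξ (ψ p)) + Real.cos θ • structV S ψ N p →
        A p W₁ = γ₁ • W₁ → A p W₂ = γ₂ • W₂ →
        γ₁ + γ₂ ≠ 0 →
        (c < (1 - 3 * m) / (1 + m) ∨ 1 < c) ∧
        0 ≤ (-(4 * (-1 + c) * m ^ 2 * (1 + m) / (-1 + c + 3 * m + c * m))
              + (-1 + m * (γ₁ + γ₂)) ^ 2) / m ^ 4 ∧
        (normH S ψ N A p = 1 / 2 * (-((-1 + m * (γ₁ + γ₂)) / m ^ 2)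
            + √((-(4 * (-1 + c) * m ^ 2 * (1 + m) / (-1 + c + 3 * m + c * m))
              + (-1 + m * (γ₁ + γ₂)) ^ 2) / m ^ 4)) ∨
         normH S ψ N A p = 1 / 2 * (-((-1 + m * (γ₁ + γ₂)) / m ^ 2)
            - √((-(4 * (-1 + c) * m ^ 2 * (1 + m) / (-1 + c + 3 * m + c * m))
              + (-1 + m * (γ₁ + γ₂)) ^ 2) / m ^ 4)))) := by
  refine ⟨0, fun m _ c P _ _ _ S hS hric M _ _ _ ψ hψ N A hN hA hHopf hbi α β hgrad => ?_⟩
  obtain ⟨hzero, hconst⟩ := mainTheorem4_general hS hric hψ hN hA hHopf.1 hbi hgrad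
  exact ⟨fun _ _ => hconst.exists_eq_const.imp fun _ => congrFun, fun _ _ ⟨p, hp⟩ => hp (hzero p).1,
    fun p _ _ _ _ _ hα => absurd (hzero p).1 hα⟩
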